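/- Let $\mathbb M=(M,<,\dots)$ be an o-minimal structure, that is, a first-order structure in any language expanding a nonempty dense linear order without endpoints such that every definable subset of $M$ is a finite union of points and open intervals with endpoints in $M\cup\{-\infty,+\infty\}$. Here and below "definable" means first-order definable in $\mathbb M$ with parameters from $M$, a map is definable if its graph is, $M$ carries the order topology and $M^k$ the product topology. Suppose that $\mathbb M$ has definable Skolem functions: for all $l,k\ge 0$, every definable $T\subseteq M^l$ and every family $(X_t)_{t\in T}$ of nonempty subsets of $M^k$ such that $\{(t,x): t\in T,\ x\in X_t\}$ is definable, there is a definable function $h:T\to M^k$ with $h(t)\in X_t$ for all $t\in T$. Let $n\ge 0$, let $O$ be an open definable subset of $M^{n+1}$, and let $\pi:M^{n+1}\to M^n$ be the projection onto the first $n$ coordinates. Then there are finitely many open definable subsets $U_1,\dots,U_m$ of $M^n$ with $\pi(O)=U_1\cup\dots\cup U_m$ and, for each $i$, a continuous definable section $s_i:U_i\to O$ of $\pi$, i.e. $\pi\circ s_i=\mathrm{id}_{U_i}$. -/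

import Mathlib

open Set FirstOrder

universe u v w

namespace OMin

section

variable (L : Language) {M : Type*} [L.Structure M]

/-- A subset of a Cartesian power of `M` is definable, with arbitrary parameters from `M`. -/
def IsDef {α : Type*} (s : Set (α → M)) : Prop :=
  (univ : Set M).Definable L s

/-- A map `f` from `A ⊆ M^l` to `M^k` is definable: its graph, a subset of `M^l × M^k`,
is definable. Only the values of `f` on `A` matter. -/
def IsDefMapOn {l k : ℕ} (A : Set (Fin l → M)) (f : (Fin l → M) → (Fin k → M)) : Prop :=
  IsDef L {p : Fin l ⊕ Fin k → M | p ∘ Sum.inl ∈ A ∧ p ∘ Sum.inr = f (p ∘ Sum.inl)}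

/-- `{X t}_{t ∈ T}` is a uniformly definable family of subsets of `M^k`: the index set
`T ⊆ M^l` is definable and so is `{(t, x) | t ∈ T, x ∈ X t} ⊆ M^l × M^k`. -/
def IsDefFamily {l k : ℕ} (T : Set (Fin l → M)) (X : (Fin l → M) → Set (Fin k → M)) : Prop :=
  IsDef L T ∧ IsDef L {p : Fin l ⊕ Fin k → M | p ∘ Sum.inl ∈ T ∧ p ∘ Sum.inr ∈ X (p ∘ Sum.inl)}

variable (M)

/-- `M` has definable Skolem functions: every uniformly definable family of nonempty sets has
a definable choice function. -/
def HasDefSkolem : Prop :=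
  ∀ (l k : ℕ) (T : Set (Fin l → M)) (X : (Fin l → M) → Set (Fin k → M)),
    IsDefFamily L T X → (∀ t ∈ T, (X t).Nonempty) →
      ∃ h : (Fin l → M) → (Fin k → M), IsDefMapOn L T h ∧ ∀ t ∈ T, h t ∈ X t

/-- A point of `M`, or an open interval with endpoints in `M ∪ {-∞, +∞}`. -/
def IsPointOrInterval {M : Type*} [LinearOrder M] (s : Set M) : Prop :=
  (∃ a, s = {a}) ∨ (∃ a b, s = Ioo a b) ∨ (∃ a, s = Iio a) ∨ (∃ a, s = Ioi a) ∨ s = univ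

/-- O-minimality: every subset of `M` definable with parameters is a finite union of points and
open intervals. -/
def IsOMinimal [LinearOrder M] : Prop :=
  ∀ S : Set M, (univ : Set M).Definable₁ L S →
    ∃ F : Set (Set M), F.Finite ∧ (∀ I ∈ F, IsPointOrInterval I) ∧ S = ⋃₀ F

end

/-- The projection `M^(n+1) → M^n` onto the first `n` coordinates. -/
def proj {M : Type*} {n : ℕ} (x : Fin (n + 1) → M) : Fin n → M :=
  fun i => x i.castSucc

end OMin

/-! ### Definable sets and maps, organised as spaces with definable parametrizations. -/

namespace OMin
open Filter Topology
set_option linter.unusedSectionVars false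

/-! Definable choice gives a definable `h` with `(x, h x) ∈ O` for every `x ∈ π(O)`, in general
discontinuous. The graph of `h` over `π(O)` is cut into finitely many graph pieces `g '' D`, with
`D` open in some `M^d`, `g` continuous, and the parameter `y ∈ D` recovered from `g y` by reading
off `d` of the first `n` coordinates (`decomposable_image`). A piece may have `d < n`, but its last
coordinate is then a continuous function of those `d` coordinates alone. It therefore extends to `s
x = (x, last coordinate of g (p x))`, where `p : M^n → M^d` selects coordinates. The set of `x` with
`p x ∈ D` and `s x ∈ O` is open and contains the base points of the piece, because `s x = (x, h x)`
there. These sets are the `U_i`.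

The decomposition is an induction on the number `d` of parameters. On an open part the map is
continuous. What is left, `Z`, has empty interior since definable maps are generically continuous
(`tame_pow`). For `d = e + 1`, project `Z` to `M^e`. The set `E` of points whose fibre contains an
interval has empty interior, so it decomposes into pieces with fewer than `e` parameters, and the
part of `Z` above them needs at most `e`. Off `E` the fibres are finite, of bounded size
(`unifFinite_pow`), and definable choice covers that part of `Z` by finitely many graphs over
subsets of `M^e`.

Generic continuity rests on the monotonicity theorem in one variable (`exists_continuous_monotone`)
and passes from `X` to `X × M`. Uniform finiteness is proved by the same induction: the number of
points in a fibre is locally constant in the last parameter away from finitely many exceptional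
values. -/

/-- A structure on a linear order `M` in the sense of o-minimality: the definable subsets of
the finite powers of `M`. -/
class DefStr (M : Type*) [LinearOrder M] where
  Def : ∀ {α : Type} [Finite α], Set (α → M) → Prop
  compl : ∀ {α : Type} [Finite α] {s : Set (α → M)}, Def s → Def sᶜ
  iInter : ∀ {α β : Type} [Finite α] [Finite β] {s : β → Set (α → M)},
    (∀ b, Def (s b)) → Def (⋂ b, s b)
  preimage : ∀ {α β : Type} [Finite α] [Finite β] (σ : α → β) {s : Set (α → M)},
    Def s → Def {v : β → M | v ∘ σ ∈ s}
  image : ∀ {α β : Type} [Finite α] [Finite β] (σ : α → β) {s : Set (β → M)},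
    Def s → Def ((fun v : β → M => v ∘ σ) '' s)
  const : ∀ c : M, Def {v : Unit → M | v () = c}
  eq : Def {v : Bool → M | v false = v true}
  lt : Def {v : Bool → M | v false < v true}

namespace DefStr
variable {M : Type*} [LinearOrder M] [DefStr M] {α β : Type} [Finite α] [Finite β]

theorem inter {s t : Set (α → M)} (hs : Def s) (ht : Def t) : Def (s ∩ t) := by
  have h : Def (⋂ b : Bool, cond b s t) := iInter (by rintro (_ | _) <;> simpa)
  have e : (⋂ b : Bool, cond b s t) = s ∩ t := by
    ext v; simp [Bool.forall_bool, and_comm]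
  rwa [e] at h

end DefStr

/-- A space over `M`, given by its definable parametrizations by finite powers of `M`. -/
class DSp (M : Type*) [LinearOrder M] [DefStr M] (X : Type*) where
  Plot : ∀ {α : Type} [Finite α], ((α → M) → X) → Prop
  reindex : ∀ {α β : Type} [Finite α] [Finite β] (σ : α → β) {γ : (α → M) → X},
    Plot γ → Plot (fun v : β → M => γ (v ∘ σ))
  const : ∀ {α : Type} [Finite α] (x : X), Plot (fun _ : α → M => x)

/-- A map between spaces over `M` is definable if it preserves definable parametrizations. -/
@[fun_prop]
structure Dfn (M : Type*) [LinearOrder M] [DefStr M] {X Y : Type*} [DSp M X] [DSp M Y]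
    (f : X → Y) : Prop where
  plot_comp : ∀ {α : Type} [Finite α] (γ : (α → M) → X), DSp.Plot γ →
    DSp.Plot (fun v => f (γ v))

section Spaces
variable {M : Type*} [LinearOrder M] [DefStr M]
variable {X Y Z W : Type*} [DSp M X] [DSp M Y] [DSp M Z] [DSp M W]

/-- Definable sets are the definable maps to `Prop`, so one notion `Dfn` serves for both sets and
maps. -/
instance : DSp M Prop where
  Plot γ := DefStr.Def {v | γ v}
  reindex σ _ h := DefStr.preimage σ h
  const {α} _ p := by
    by_cases hp : p
    · have h : DefStr.Def (⋂ b : Empty, (∅ : Set (α → M))) := DefStr.iInter (fun b => b.elim)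
      simpa [hp] using h
    · have h : DefStr.Def (⋂ b : Empty, (∅ : Set (α → M))) := DefStr.iInter (fun b => b.elim)
      simpa [hp] using DefStr.compl h

/-- Definability of the graph; the index `none` carries the value. -/
instance : DSp M M where
  Plot {α} _ γ := DefStr.Def {v : Option α → M | v none = γ (fun a => v (some a))}
  reindex σ _ h := DefStr.preimage (Option.map σ) h
  const c := DefStr.preimage (fun _ => none) (DefStr.const c)

instance : DSp M (X × Y) where
  Plot γ := DSp.Plot (fun v => (γ v).1) ∧ DSp.Plot (fun v => (γ v).2)
  reindex σ _ h := ⟨DSp.reindex σ h.1, DSp.reindex σ h.2⟩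
  const x := ⟨DSp.const x.1, DSp.const x.2⟩

instance {ι : Type*} : DSp M (ι → X) where
  Plot γ := ∀ i, DSp.Plot (fun v => γ v i)
  reindex σ _ h := fun i => DSp.reindex σ (h i)
  const x := fun i => DSp.const (x i)

@[fun_prop]
theorem Dfn.id : Dfn M (fun x : X => x) := ⟨fun _ h => h⟩

@[fun_prop]
theorem Dfn.const (y : Y) : Dfn M (fun _ : X => y) := ⟨fun _ _ => DSp.const y⟩

@[fun_prop]
theorem Dfn.comp {f : Y → Z} {g : X → Y} (hf : Dfn M f) (hg : Dfn M g) :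
    Dfn M (fun x => f (g x)) := ⟨fun γ h => hf.1 _ (hg.1 γ h)⟩

@[fun_prop]
theorem Dfn.fst : Dfn M (fun p : X × Y => p.1) := ⟨fun _ h => h.1⟩

@[fun_prop]
theorem Dfn.snd : Dfn M (fun p : X × Y => p.2) := ⟨fun _ h => h.2⟩

@[fun_prop]
theorem Dfn.prodMk {f : X → Y} {g : X → Z} (hf : Dfn M f) (hg : Dfn M g) :
    Dfn M (fun x => (f x, g x)) := ⟨fun γ h => ⟨hf.1 γ h, hg.1 γ h⟩⟩

@[fun_prop]
theorem Dfn.pi {ι : Type*} {f : X → ι → Y} (hf : ∀ i, Dfn M (fun x => f x i)) :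
    Dfn M (fun x i => f x i) := ⟨fun γ h i => (hf i).1 γ h⟩

@[fun_prop]
theorem Dfn.apply {ι : Type*} (i : ι) : Dfn M (fun x : ι → X => x i) := ⟨fun _ h => h i⟩

theorem plot_coord {α : Type} [Finite α] (a : α) : DSp.Plot (M := M) (fun v : α → M => v a) :=
  DefStr.preimage (fun b : Bool => cond b (some a) none) DefStr.eq

theorem plot_id {α : Type} [Finite α] : DSp.Plot (M := M) (fun v : α → M => v) :=
  fun a => plot_coord a

theorem Dfn.plot {α : Type} [Finite α] {f : (α → M) → X} (hf : Dfn M f) : DSp.Plot f :=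
  hf.1 _ plot_id

/-- Substitution of definable functions in a definable set. -/
theorem def_subst {α β : Type} [Finite α] [Finite β] {s : Set (β → M)} (hs : DefStr.Def s)
    {γ : (α → M) → β → M} (hγ : DSp.Plot γ) : DefStr.Def {v | γ v ∈ s} := by
  -- The values of `γ` become extra coordinates, constrained by its graph, and are then projected
  -- away.
  have h1 : DefStr.Def (⋂ b : β, {u : α ⊕ β → M | u (Sum.inr b) = γ (fun a => u (Sum.inl a)) b}) :=
    DefStr.iInter fun b => DefStr.preimage
      (fun o : Option α => o.elim (Sum.inr b) Sum.inl) (hγ b)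
  have h2 := DefStr.inter h1 (DefStr.preimage (Sum.inr : β → α ⊕ β) hs)
  convert DefStr.image (Sum.inl : α → α ⊕ β) h2 using 1
  ext v
  simp only [Set.mem_ofPred_eq, mem_image, mem_inter_iff, mem_iInter]
  constructor
  · intro h
    exact ⟨Sum.elim v (γ v), ⟨fun b => rfl, h⟩, rfl⟩
  · rintro ⟨u, ⟨h1, h2⟩, rfl⟩
    convert h2 using 1
    ext b
    exact (h1 b).symm

theorem dfn_iff_def {β : Type} [Finite β] {P : (β → M) → Prop} :
    Dfn M P ↔ DefStr.Def {v | P v} :=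
  ⟨fun h => h.plot, fun h => ⟨fun _ hγ => def_subst h hγ⟩⟩

@[fun_prop]
theorem Dfn.not {P : X → Prop} (hP : Dfn M P) : Dfn M (fun x => ¬ P x) :=
  ⟨fun γ h => DefStr.compl (hP.1 γ h)⟩

@[fun_prop]
theorem Dfn.and {P Q : X → Prop} (hP : Dfn M P) (hQ : Dfn M Q) : Dfn M (fun x => P x ∧ Q x) :=
  ⟨fun γ h => DefStr.inter (hP.1 γ h) (hQ.1 γ h)⟩

@[fun_prop]
theorem Dfn.or {P Q : X → Prop} (hP : Dfn M P) (hQ : Dfn M Q) : Dfn M (fun x => P x ∨ Q x) := by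
  have : Dfn M (fun x => ¬ (¬ P x ∧ ¬ Q x)) := by fun_prop
  simpa only [not_and_or, not_not] using this

theorem Dfn.imp {P Q : X → Prop} (hP : Dfn M P) (hQ : Dfn M Q) : Dfn M (fun x => P x → Q x) := by
  have : Dfn M (fun x => ¬ P x ∨ Q x) := by fun_prop
  simpa only [imp_iff_not_or] using this

@[fun_prop]
theorem Dfn.iff {P Q : X → Prop} (hP : Dfn M P) (hQ : Dfn M Q) : Dfn M (fun x => P x ↔ Q x) := by
  have : Dfn M (fun x => (P x ∧ Q x) ∨ (¬ P x ∧ ¬ Q x)) := by fun_prop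
  simpa only [iff_iff_and_or_not_and_not] using this

theorem Dfn.forall_fin {ι : Type} [Finite ι] {P : X → ι → Prop}
    (hP : ∀ i, Dfn M (fun x => P x i)) : Dfn M (fun x => ∀ i, P x i) := by
  refine ⟨fun {α} _ γ h => ?_⟩
  have := DefStr.iInter fun i => (hP i).1 γ h
  rwa [← Set.ofPred_forall] at this

theorem dfn_lt : Dfn M (fun p : M × M => p.1 < p.2) := by
  refine ⟨fun {α} _ γ h => ?_⟩
  refine def_subst (γ := fun v b => cond b (γ v).2 (γ v).1) DefStr.lt ?_
  rintro (_ | _)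
  exacts [h.1, h.2]

theorem dfn_eq : Dfn M (fun p : M × M => p.1 = p.2) := by
  refine ⟨fun {α} _ γ h => ?_⟩
  refine def_subst (γ := fun v b => cond b (γ v).2 (γ v).1) DefStr.eq ?_
  rintro (_ | _)
  exacts [h.1, h.2]

end Spaces

/-! ### Spaces isomorphic to powers of `M`, and quantifiers over them. -/

/-- A space over `M` that is definably isomorphic to a finite power of `M`. -/
class RSp (M : Type*) [LinearOrder M] [DefStr M] (X : Type*) [DSp M X] : Prop where
  rep : ∃ (n : ℕ) (e : X ≃ (Fin n → M)), Dfn M e ∧ Dfn M e.symm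

section Rep
variable {M : Type*} [LinearOrder M] [DefStr M]
variable {X Y Z : Type*} [DSp M X] [DSp M Y] [DSp M Z]

theorem RSp.of_finite {ι : Type} [Finite ι] (e : X ≃ (ι → M)) (h : Dfn M e) (h' : Dfn M e.symm) :
    RSp M X := by
  obtain ⟨n, ⟨k⟩⟩ := Finite.exists_equiv_fin ι
  refine ⟨n, e.trans (Equiv.arrowCongr k (Equiv.refl M)), ?_, ?_⟩
  · show Dfn M (fun x i => e x (k.symm i))
    fun_prop
  · show Dfn M (fun x : Fin n → M => e.symm (fun i => x (k i)))
    fun_prop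

instance {ι : Type} [Finite ι] : RSp M (ι → M) :=
  RSp.of_finite (Equiv.refl _) Dfn.id Dfn.id

instance : RSp M M :=
  RSp.of_finite (Equiv.funUnique Unit M).symm
    (by show Dfn M (fun x (_ : Unit) => x); fun_prop)
    (by show Dfn M (fun x : Unit → M => x ()); fun_prop)

instance [RSp M X] [RSp M Y] : RSp M (X × Y) := by
  obtain ⟨n, e, he, he'⟩ := RSp.rep (M := M) (X := X)
  obtain ⟨k, e2, he2, he2'⟩ := RSp.rep (M := M) (X := Y)
  refine RSp.of_finite (ι := Fin n ⊕ Fin k)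
    ((e.prodCongr e2).trans (Equiv.sumArrowEquivProdArrow _ _ _).symm) ?_ ?_
  · show Dfn M (fun p : X × Y => Sum.elim (e p.1) (e2 p.2))
    refine Dfn.pi ?_
    rintro (i | i) <;> simp only [Sum.elim_inl, Sum.elim_inr] <;> fun_prop
  · show Dfn M (fun v : Fin n ⊕ Fin k → M =>
      (e.symm (fun i => v (Sum.inl i)), e2.symm (fun i => v (Sum.inr i))))
    fun_prop

/-- Coordinates on `Y` turn the quantifier into a projection along finitely many coordinates of `M`.
-/
theorem Dfn.exists [RSp M Y] {P : X → Y → Prop} (hP : Dfn M (fun p : X × Y => P p.1 p.2)) :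
    Dfn M (fun x => ∃ y, P x y) := by
  refine ⟨fun {α} _ γ h => ?_⟩
  obtain ⟨n, e, he, he'⟩ := RSp.rep (M := M) (X := Y)
  have h1 : DSp.Plot (fun u : α ⊕ Fin n → M =>
      (γ (fun a => u (Sum.inl a)), e.symm (fun i => u (Sum.inr i)))) :=
    ⟨DSp.reindex Sum.inl h, DSp.reindex Sum.inr he'.plot⟩
  change DefStr.Def {v | ∃ y, P (γ v) y}
  convert DefStr.image (Sum.inl : α → α ⊕ Fin n) (hP.1 _ h1) using 1
  ext v
  constructor
  · rintro ⟨y, hy⟩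
    exact ⟨Sum.elim v (e y), by simpa using hy, rfl⟩
  · rintro ⟨u, hu, rfl⟩
    exact ⟨_, hu⟩

theorem Dfn.forall [RSp M Y] {P : X → Y → Prop} (hP : Dfn M (fun p : X × Y => P p.1 p.2)) :
    Dfn M (fun x => ∀ y, P x y) := by
  have : Dfn M (fun x => ¬ ∃ y, ¬ P x y) := by
    have := Dfn.exists (M := M) (X := X) (Y := Y) (P := fun x y => ¬ P x y) (by fun_prop)
    fun_prop
  simpa using this

attribute [fun_prop] Dfn.exists

theorem Dfn.eq [RSp M Y] {f g : X → Y} (hf : Dfn M f) (hg : Dfn M g) :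
    Dfn M (fun x => f x = g x) := by
  obtain ⟨n, e, he, -⟩ := RSp.rep (M := M) (X := Y)
  have : Dfn M (fun x => ∀ i, e (f x) i = e (g x) i) :=
    Dfn.forall_fin fun i => Dfn.comp dfn_eq (Dfn.prodMk (by fun_prop) (by fun_prop))
  simpa only [← funext_iff, e.injective.eq_iff] using this

/-- The graph of each coordinate of `f` is a projection of the graph of `f`. -/
theorem Dfn.of_graph [RSp M Y] {f : X → Y} (h : Dfn M (fun p : X × Y => p.2 = f p.1)) :
    Dfn M f := by
  obtain ⟨n, e, he, he'⟩ := RSp.rep (M := M) (X := Y)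
  have key : ∀ i, Dfn M (fun x => e (f x) i) := by
    refine fun i => ⟨fun {α} _ γ hγ => ?_⟩
    have h1 : Dfn M (fun p : X × M => ∃ y : Y, y = f p.1 ∧ p.2 = e y i) := by
      refine Dfn.exists (Dfn.and ?_ (Dfn.eq (by fun_prop) (by fun_prop)))
      exact Dfn.comp h (f := fun p : X × Y => p.2 = f p.1) (g := fun q : (X × M) × Y => (q.1.1, q.2))
        (by fun_prop)
    have h2 := h1.1 (fun v : Option α → M => (γ (fun a => v (some a)), v none))
      ⟨DSp.reindex some hγ, plot_coord none⟩
    simp only [exists_eq_left] at h2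
    exact h2
  have : Dfn M (fun x => e.symm (fun i => e (f x) i)) := Dfn.comp he' (Dfn.pi key)
  simpa using this

end Rep

/-! ### O-minimality, definable choice and the order dual. -/

/-- An o-minimal structure with definable Skolem functions. -/
class OMinSk (M : Type*) [LinearOrder M] [DefStr M] : Prop where
  omin : ∀ {P : M → Prop}, Dfn M P →
    ∃ F : Set (Set M), F.Finite ∧ (∀ I ∈ F, IsPointOrInterval I) ∧ {x | P x} = ⋃₀ F
  skolem_pow : ∀ {l k : ℕ} {R : (Fin l → M) → (Fin k → M) → Prop},
    Dfn M (fun p : (Fin l → M) × (Fin k → M) => R p.1 p.2) →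
      ∃ h : (Fin l → M) → (Fin k → M), Dfn M h ∧ ∀ t, (∃ y, R t y) → R t (h t)

theorem skolem {M : Type*} [LinearOrder M] [DefStr M] [OMinSk M]
    {X Y : Type*} [DSp M X] [DSp M Y] [RSp M X] [RSp M Y] {R : X → Y → Prop}
    (hR : Dfn M (fun p : X × Y => R p.1 p.2)) :
    ∃ h : X → Y, Dfn M h ∧ ∀ t, (∃ y, R t y) → R t (h t) := by
  obtain ⟨n, e, he, he'⟩ := RSp.rep (M := M) (X := X)
  obtain ⟨k, e2, he2, he2'⟩ := RSp.rep (M := M) (X := Y)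
  obtain ⟨h, hd, hh⟩ := OMinSk.skolem_pow (M := M) (l := n) (k := k)
    (R := fun t y => R (e.symm t) (e2.symm y)) (by fun_prop)
  refine ⟨fun x => e2.symm (h (e x)), by fun_prop, fun t ⟨y, hy⟩ => ?_⟩
  simpa using hh (e t) ⟨e2 y, by simpa using hy⟩

/-- A linearly ordered space over `M` that is definably isomorphic to a power of `M` and
o-minimal: in practice `M` itself or its order dual. -/
class Line (M : Type*) [LinearOrder M] [DefStr M] (D : Type*) [LinearOrder D] [DSp M D] : Prop
    extends RSp M D where
  dfn_lt : Dfn M (fun p : D × D => p.1 < p.2)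
  omin : ∀ {P : D → Prop}, Dfn M P →
    ∃ F : Set (Set D), F.Finite ∧ (∀ I ∈ F, IsPointOrInterval I) ∧ {x | P x} = ⋃₀ F

section Lines
variable {M : Type*} [LinearOrder M] [DefStr M]

instance [OMinSk M] : Line M M where
  dfn_lt := OMin.dfn_lt
  omin := OMinSk.omin

section Dual
variable {D : Type*} [DSp M D]

instance : DSp M Dᵒᵈ := inferInstanceAs (DSp M D)

@[fun_prop]
theorem dfn_toDual : Dfn M (OrderDual.toDual : D → Dᵒᵈ) := ⟨fun _ h => h⟩

@[fun_prop]
theorem dfn_ofDual : Dfn M (OrderDual.ofDual : Dᵒᵈ → D) := ⟨fun _ h => h⟩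

theorem IsPointOrInterval.dual {D : Type*} [LinearOrder D] {I : Set D} (h : IsPointOrInterval I) :
    IsPointOrInterval (OrderDual.ofDual ⁻¹' I) := by
  rcases h with ⟨a, rfl⟩ | ⟨a, b, rfl⟩ | ⟨a, rfl⟩ | ⟨a, rfl⟩ | rfl
  · exact Or.inl ⟨OrderDual.toDual a, rfl⟩
  · exact Or.inr (Or.inl ⟨OrderDual.toDual b, OrderDual.toDual a, Set.ext fun x => and_comm⟩)
  · exact Or.inr (Or.inr (Or.inr (Or.inl ⟨OrderDual.toDual a, rfl⟩)))
  · exact Or.inr (Or.inr (Or.inl ⟨OrderDual.toDual a, rfl⟩))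
  · exact Or.inr (Or.inr (Or.inr (Or.inr rfl)))

/-- Makes every one-variable result available with left and right, or increasing and decreasing,
exchanged. -/
instance [LinearOrder D] [Line M D] : Line M Dᵒᵈ where
  rep := RSp.rep (M := M) (X := D)
  dfn_lt := by
    have : Dfn M (fun p : Dᵒᵈ × Dᵒᵈ => (OrderDual.ofDual p.2, OrderDual.ofDual p.1)) := by fun_prop
    exact Dfn.comp (Line.dfn_lt (D := D)) this
  omin {P} hP := by
    obtain ⟨F, hF, hI, h⟩ := Line.omin (M := M) (P := fun x : D => P (OrderDual.toDual x))
      (by fun_prop)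
    refine ⟨(OrderDual.ofDual ⁻¹' ·) '' F, hF.image _, ?_, ?_⟩
    · rintro _ ⟨I, hIF, rfl⟩
      exact (hI I hIF).dual
    · rw [sUnion_image, ← preimage_iUnion₂, ← sUnion_eq_biUnion, ← h]
      rfl

end Dual

variable {D : Type*} [LinearOrder D] [DSp M D] [Line M D] {X : Type*} [DSp M X]

@[fun_prop]
theorem Dfn.lt {f g : X → D} (hf : Dfn M f) (hg : Dfn M g) : Dfn M (fun x => f x < g x) :=
  Dfn.comp Line.dfn_lt (Dfn.prodMk hf hg)

@[fun_prop]
theorem Dfn.le {f g : X → D} (hf : Dfn M f) (hg : Dfn M g) : Dfn M (fun x => f x ≤ g x) := by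
  have : Dfn M (fun x => ¬ g x < f x) := by fun_prop
  simpa only [not_lt] using this

end Lines

/-! ### Definable sets in one variable. -/

section OneVar
variable {M : Type*} [LinearOrder M] [DefStr M] {D : Type*} [LinearOrder D] [DSp M D] [Line M D]
  {P : D → Prop}

/-- A filter that decides on which side of each `c` it lies decides membership in every point and
interval, hence in every finite union of these. -/
theorem eventually_or_not {l : Filter D} (hl : ∀ c, (∀ᶠ x in l, x < c) ∨ (∀ᶠ x in l, c < x))
    (hP : Dfn M P) : (∀ᶠ x in l, P x) ∨ (∀ᶠ x in l, ¬ P x) := by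
  obtain ⟨F, hF, hI, hPF⟩ := Line.omin hP
  have hlt : ∀ c, (∀ᶠ x in l, x < c) ∨ (∀ᶠ x in l, ¬ x < c) := fun c =>
    (hl c).imp id (fun h => h.mono fun x hx => not_lt.2 hx.le)
  have hgt : ∀ c, (∀ᶠ x in l, c < x) ∨ (∀ᶠ x in l, ¬ c < x) := fun c =>
    (hl c).symm.imp id (fun h => h.mono fun x hx => not_lt.2 hx.le)
  have key : ∀ I ∈ F, (∀ᶠ x in l, x ∈ I) ∨ (∀ᶠ x in l, x ∉ I) := by
    intro I hIF
    rcases hI I hIF with ⟨a, rfl⟩ | ⟨a, b, rfl⟩ | ⟨a, rfl⟩ | ⟨a, rfl⟩ | rfl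
    · exact Or.inr ((hl a).elim (fun h => h.mono fun x hx => hx.ne)
        (fun h => h.mono fun x hx => hx.ne'))
    · rcases hgt a with h1 | h1
      · rcases hlt b with h2 | h2
        · exact Or.inl (h1.and h2)
        · exact Or.inr (h2.mono fun x hx h => hx h.2)
      · exact Or.inr (h1.mono fun x hx h => hx h.1)
    · exact hlt a
    · exact hgt a
    · exact Or.inl (by simp)
  have hPx : ∀ x, P x ↔ ∃ I ∈ F, x ∈ I := fun x => Set.ext_iff.1 hPF x
  by_cases h : ∃ I ∈ F, ∀ᶠ x in l, x ∈ I
  · obtain ⟨I, hIF, h⟩ := h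
    exact Or.inl (h.mono fun x hx => (hPx x).2 ⟨I, hIF, hx⟩)
  · push Not at h
    refine Or.inr ?_
    have : ∀ᶠ x in l, ∀ I ∈ F, x ∉ I := by
      rw [eventually_all_finite hF]
      exact fun I hIF => (key I hIF).resolve_left (not_eventually.2 (h I hIF))
    exact this.mono fun x hx hPx' => by
      obtain ⟨I, hIF, hxI⟩ := (hPx x).1 hPx'
      exact hx I hIF hxI

/-- Definable completeness: nonempty bounded points and intervals have suprema, and suprema pass to
finite unions. It replaces completeness of the order throughout. -/
theorem exists_isLUB [DenselyOrdered D] [NoMinOrder D] [NoMaxOrder D] (hP : Dfn M P)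
    (hne : ∃ x, P x) (hb : ∃ b, ∀ x, P x → x ≤ b) : ∃ s, IsLUB {x | P x} s := by
  obtain ⟨F, hF, hI, hPF⟩ := Line.omin hP
  have hne' : (⋃₀ F).Nonempty := hPF ▸ hne
  have hb' : BddAbove (⋃₀ F) := hPF ▸ hb
  rw [hPF]
  clear hPF hne hb hP
  induction F, hF using Set.Finite.induction_on with
  | empty => simp at hne'
  | @insert I F hIF hF ih =>
    have hF' := fun h1 => ih (fun J hJ => hI J (mem_insert_of_mem _ hJ)) h1
      (hb'.mono (sUnion_mono (subset_insert _ _)))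
    rw [sUnion_insert] at hne' hb' ⊢
    have hI' : I.Nonempty → ∃ s, IsLUB I s := by
      intro hIne
      have hbI : BddAbove I := hb'.mono subset_union_left
      rcases hI I (mem_insert _ _) with ⟨a, rfl⟩ | ⟨a, b, rfl⟩ | ⟨a, rfl⟩ | ⟨a, rfl⟩ | rfl
      · exact ⟨a, isLUB_singleton⟩
      · exact ⟨b, isLUB_Ioo (nonempty_Ioo.1 hIne)⟩
      · exact ⟨a, isLUB_Iio⟩
      · exact absurd hbI (not_bddAbove_Ioi a)
      · have := hIne.to_subtype
        have : Nonempty D := hIne.nonempty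
        exact absurd hbI not_bddAbove_univ
    rcases I.eq_empty_or_nonempty with rfl | h1
    · simp only [empty_union] at hne' ⊢
      exact hF' hne'
    · obtain ⟨s, hs⟩ := hI' h1
      rcases (⋃₀ F).eq_empty_or_nonempty with h2 | h2
      · exact ⟨s, by rwa [h2, union_empty]⟩
      · obtain ⟨t, ht⟩ := hF' h2
        exact ⟨s ⊔ t, hs.union ht⟩

theorem exists_isGLB [DenselyOrdered D] [NoMinOrder D] [NoMaxOrder D] (hP : Dfn M P)
    (hne : ∃ x, P x) (hb : ∃ b, ∀ x, P x → b ≤ x) : ∃ s, IsGLB {x | P x} s := by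
  obtain ⟨y, hy⟩ := hne
  obtain ⟨s, hs⟩ := exists_isLUB (P := fun b => ∀ x, P x → b ≤ x)
    (Dfn.forall (Dfn.imp (by fun_prop) (by fun_prop))) hb ⟨y, fun b hb => hb y hy⟩
  exact ⟨s, isLUB_lowerBounds.1 hs⟩

/-- If a finite union is infinite then so is one of its members, which must then be an interval. -/
theorem exists_Icc_of_infinite [DenselyOrdered D] [NoMinOrder D] [NoMaxOrder D] (hP : Dfn M P)
    (h : {x | P x}.Infinite) : ∃ a b, a < b ∧ ∀ x, a ≤ x → x ≤ b → P x := by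
  obtain ⟨F, hF, hI, hPF⟩ := Line.omin hP
  have : ∃ I ∈ F, I.Infinite := by
    by_contra! hcon
    exact h (hPF ▸ hF.sUnion (fun I hI => by simpa using hcon I hI))
  obtain ⟨I, hIF, hinf⟩ := this
  have hsub : ∀ x ∈ I, P x := fun x hx => by
    have : x ∈ ⋃₀ F := ⟨I, hIF, hx⟩
    rwa [← hPF] at this
  have : ∃ c d, c < d ∧ Ioo c d ⊆ I := by
    obtain ⟨x, hx⟩ := hinf.nonempty
    obtain ⟨y, hy⟩ := exists_lt x
    obtain ⟨z, hz⟩ := exists_gt x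
    rcases hI I hIF with ⟨a, rfl⟩ | ⟨a, b, rfl⟩ | ⟨a, rfl⟩ | ⟨a, rfl⟩ | rfl
    · exact absurd (finite_singleton a) hinf
    · exact ⟨a, b, nonempty_Ioo.1 ⟨x, hx⟩, Subset.rfl⟩
    · exact ⟨x, a, hx, fun u hu => hu.2⟩
    · exact ⟨a, x, hx, fun u hu => hu.1⟩
    · exact ⟨x, z, hz, subset_univ _⟩
  obtain ⟨c, d, hcd, hs⟩ := this
  obtain ⟨a, hca, had⟩ := exists_between hcd
  obtain ⟨b, hab, hbd⟩ := exists_between had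
  exact ⟨a, b, hab, fun x h1 h2 => hsub x (hs ⟨hca.trans_le h1, h2.trans_lt hbd⟩)⟩

/-- An interval contains a closed subinterval on which a given definable predicate is constant. -/
theorem exists_Icc_or_not [DenselyOrdered D] [NoMinOrder D] [NoMaxOrder D] (hP : Dfn M P)
    {a b : D} (hab : a < b) :
    ∃ c d, a < c ∧ c < d ∧ d < b ∧ ((∀ x, c ≤ x → x ≤ d → P x) ∨ (∀ x, c ≤ x → x ≤ d → ¬ P x)) := by
  have key : ∀ Q : D → Prop, Dfn M Q → {x | (a < x ∧ x < b) ∧ Q x}.Infinite →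
      ∃ c d, a < c ∧ c < d ∧ d < b ∧ (∀ x, c ≤ x → x ≤ d → Q x) := by
    intro Q hQ hinf
    obtain ⟨c, d, hcd, h⟩ := exists_Icc_of_infinite (M := M) (P := fun x => (a < x ∧ x < b) ∧ Q x)
      (by fun_prop) hinf
    exact ⟨c, d, (h c le_rfl hcd.le).1.1, hcd, (h d hcd.le le_rfl).1.2, fun x h1 h2 => (h x h1 h2).2⟩
  by_cases h : {x | (a < x ∧ x < b) ∧ P x}.Infinite
  · obtain ⟨c, d, h1, h2, h3, h4⟩ := key P hP h
    exact ⟨c, d, h1, h2, h3, Or.inl h4⟩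
  · obtain ⟨c, d, h1, h2, h3, h4⟩ := key (fun x => ¬ P x) (by fun_prop) (by
      have := (Ioo_infinite hab).sdiff (not_infinite.1 h)
      refine this.mono ?_
      rintro x ⟨hx, hx'⟩
      exact ⟨hx, fun hP => hx' ⟨hx, hP⟩⟩)
    exact ⟨c, d, h1, h2, h3, Or.inr h4⟩

end OneVar

/-! ### One-sided germs and induction along intervals. -/

section Germs
variable {M : Type*} [LinearOrder M] [DefStr M] {D : Type*} [LinearOrder D] [DSp M D] [Line M D]
  [TopologicalSpace D] [OrderTopology D] {P : D → Prop}

theorem eventually_nhdsGT_or_not (hP : Dfn M P) (a : D) :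
    (∀ᶠ x in 𝓝[>] a, P x) ∨ (∀ᶠ x in 𝓝[>] a, ¬ P x) := by
  refine eventually_or_not (fun c => ?_) hP
  rcases lt_or_ge a c with h | h
  · exact Or.inl (eventually_nhdsWithin_of_eventually_nhds (eventually_lt_nhds h))
  · exact Or.inr (eventually_nhdsWithin_of_forall fun x hx => h.trans_lt hx)

theorem eventually_nhdsLT_or_not (hP : Dfn M P) (a : D) :
    (∀ᶠ x in 𝓝[<] a, P x) ∨ (∀ᶠ x in 𝓝[<] a, ¬ P x) := by
  refine eventually_or_not (fun c => ?_) hP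
  rcases lt_or_ge c a with h | h
  · exact Or.inr (eventually_nhdsWithin_of_eventually_nhds (eventually_gt_nhds h))
  · exact Or.inl (eventually_nhdsWithin_of_forall fun x hx => hx.trans_le h)

variable [NoMinOrder D] [NoMaxOrder D] [DenselyOrdered D]

theorem eventually_nhdsGT_iff {a : D} :
    (∀ᶠ x in 𝓝[>] a, P x) ↔ ∃ u, a < u ∧ ∀ x, a < x → x < u → P x := by
  rw [Filter.Eventually, mem_nhdsGT_iff_exists_Ioo_subset]
  exact exists_congr fun u => and_congr Iff.rfl ⟨fun h x h1 h2 => h ⟨h1, h2⟩,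
    fun h x hx => h x hx.1 hx.2⟩

theorem eventually_nhdsLT_iff {a : D} :
    (∀ᶠ x in 𝓝[<] a, P x) ↔ ∃ u, u < a ∧ ∀ x, u < x → x < a → P x := by
  rw [Filter.Eventually, mem_nhdsLT_iff_exists_Ioo_subset]
  exact exists_congr fun u => and_congr Iff.rfl ⟨fun h x h1 h2 => h ⟨h1, h2⟩,
    fun h x hx => h x hx.1 hx.2⟩

theorem eventually_nhds_iff_Ioo {a : D} :
    (∀ᶠ x in 𝓝 a, P x) ↔ ∃ u v, u < a ∧ a < v ∧ ∀ x, u < x → x < v → P x := by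
  rw [Filter.Eventually, mem_nhds_iff_exists_Ioo_subset]
  exact exists_congr fun u => exists_congr fun v => ⟨fun h => ⟨h.1.1, h.1.2, fun x h1 h2 => h.2 ⟨h1, h2⟩⟩,
    fun h => ⟨⟨h.1, h.2.1⟩, fun x hx => h.2.2 x hx.1 hx.2⟩⟩

variable {X : Type*} [DSp M X]

theorem Dfn.eventually_nhdsGT {R : X → D → Prop} (hR : Dfn M (fun p : X × D => R p.1 p.2))
    {g : X → D} (hg : Dfn M g) : Dfn M (fun x => ∀ᶠ y in 𝓝[>] (g x), R x y) := by
  simp only [eventually_nhdsGT_iff]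
  exact Dfn.exists (Dfn.and (by fun_prop) (Dfn.forall
    (Dfn.imp (by fun_prop) (Dfn.imp (by fun_prop) (by fun_prop)))))

theorem Dfn.eventually_nhdsLT {R : X → D → Prop} (hR : Dfn M (fun p : X × D => R p.1 p.2))
    {g : X → D} (hg : Dfn M g) : Dfn M (fun x => ∀ᶠ y in 𝓝[<] (g x), R x y) := by
  simp only [eventually_nhdsLT_iff]
  exact Dfn.exists (Dfn.and (by fun_prop) (Dfn.forall
    (Dfn.imp (by fun_prop) (Dfn.imp (by fun_prop) (by fun_prop)))))

/-- Induction along an interval, for definable predicates. -/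
theorem interval_induction (hP : Dfn M P) {a b : D} (h0 : ∀ᶠ y in 𝓝[>] a, P y)
    (h1 : ∀ s, a < s → s ≤ b → (∀ y, a < y → y < s → P y) → P s)
    (h2 : ∀ s, a < s → s < b → P s → ∀ᶠ y in 𝓝[>] s, P y) :
    ∀ x, a < x → x ≤ b → P x := by
  by_contra! hcon
  obtain ⟨x, hax, hxb, hx⟩ := hcon
  -- `s` is the infimum of the counterexamples: `h0` puts it strictly above `a`, `h1` makes it
  -- satisfy `P`, and `h2` then pushes the infimum further right.
  obtain ⟨s, hs⟩ := exists_isGLB (M := M) (P := fun y => a < y ∧ y ≤ b ∧ ¬ P y) (by fun_prop)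
    ⟨x, hax, hxb, hx⟩ ⟨a, fun y hy => hy.1.le⟩
  obtain ⟨u, hau, hu⟩ := eventually_nhdsGT_iff.1 h0
  have has : a < s := hau.trans_le (hs.2 fun y hy => not_lt.1 fun h => hy.2.2 (hu y hy.1 h))
  have hsx : s ≤ x := hs.1 ⟨hax, hxb, hx⟩
  have hbelow : ∀ y, a < y → y < s → P y := fun y h3 h4 => by
    by_contra h5
    exact absurd (hs.1 ⟨h3, (h4.trans_le (hsx.trans hxb)).le, h5⟩) (not_le.2 h4)
  have hPs := h1 s has (hsx.trans hxb) hbelow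
  have hsx' : s < x := lt_of_le_of_ne hsx (by rintro rfl; exact hx hPs)
  obtain ⟨v, hsv, hv⟩ := eventually_nhdsGT_iff.1 (h2 s has (hsx'.trans_le hxb) hPs)
  refine absurd (hs.2 (show v ∈ lowerBounds _ from fun y hy => ?_)) (not_le.2 hsv)
  refine not_lt.1 fun h => hy.2.2 ?_
  rcases eq_or_lt_of_le (hs.1 hy) with rfl | h3
  · exact hPs
  · exact hv y h3 h

end Germs

/-! ### Passage from first-order structures to the abstract setting. -/

section Language
variable (L : FirstOrder.Language.{u, v}) {M : Type w} [L.Structure M]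

theorem isDef_setOf_lt [L.IsOrdered] [LinearOrder M] [L.OrderedStructure M] :
    IsDef L {v : Bool → M | v false < v true} := by
  refine Set.Definable.mono ((Set.empty_definable_iff (L := L)).2
    ⟨FirstOrder.Language.Term.lt (FirstOrder.Language.Term.var (Sum.inl false))
      (FirstOrder.Language.Term.var (Sum.inl true)), ?_⟩) (empty_subset _)
  ext v
  simp [FirstOrder.Language.Formula.Realize]

/-- The definable sets of a first-order structure, as an abstract structure. -/
@[reducible] def defStr [L.IsOrdered] [LinearOrder M] [L.OrderedStructure M] : DefStr M where
  Def s := IsDef L s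
  compl h := h.compl
  iInter h := Set.definable_iInter_of_finite h
  preimage σ _ h := h.preimage_comp σ
  image σ _ h := h.image_comp σ
  const c := by
    refine ⟨FirstOrder.Language.Term.equal (FirstOrder.Language.var ()) 
       ((L.con (⟨c, mem_univ c⟩ : (univ : Set M))).term), ?_⟩
    ext v
    simp
  eq := by
    refine ⟨FirstOrder.Language.Term.equal (FirstOrder.Language.var false) (FirstOrder.Language.var true), ?_⟩
    ext v
    simp
  lt := isDef_setOf_lt L

theorem ominSk [L.IsOrdered] [LinearOrder M] [L.OrderedStructure M] [Nonempty M]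
    (homin : IsOMinimal L M) (hskolem : HasDefSkolem L M) :
    letI := defStr L (M := M)
    OMinSk M := by
  let _ := defStr L (M := M)
  refine ⟨fun {P} hP => ?_, fun {l k R} hR => ?_⟩
  · have h1 : Dfn M (fun v : Fin 1 → M => P (v 0)) := by fun_prop
    exact homin {x | P x} (dfn_iff_def.1 h1)
  · have hT : Dfn M (fun t => ∃ y, R t y) := by fun_prop
    have hX : Dfn M (fun p : Fin l ⊕ Fin k → M => (∃ y, R (fun i => p (Sum.inl i)) y) ∧
        R (fun i => p (Sum.inl i)) (fun i => p (Sum.inr i))) := by fun_prop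
    obtain ⟨h, hd, hh⟩ := hskolem l k {t | ∃ y, R t y} (fun t => {y | R t y})
      ⟨dfn_iff_def.1 hT, dfn_iff_def.1 hX⟩ (fun t ht => ht)
    classical
    obtain ⟨c⟩ := ‹Nonempty M›
    -- The choice function is controlled only on the set where a witness exists; the constant value
    -- `c` elsewhere makes it total with definable graph.
    refine ⟨fun t => if ∃ y, R t y then h t else fun _ => c, Dfn.of_graph ?_,
      fun t ht => by simp only [if_pos ht]; exact hh t ht⟩
    have hd' : Dfn M (fun p : Fin l ⊕ Fin k → M =>
        (∃ y, R (p ∘ Sum.inl) y) ∧ p ∘ Sum.inr = h (p ∘ Sum.inl)) := dfn_iff_def.2 hd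
    have h1 : Dfn M (fun p : (Fin l → M) × (Fin k → M) => Sum.elim p.1 p.2) := by
      refine Dfn.pi ?_
      rintro (i | i) <;> simp only [Sum.elim_inl, Sum.elim_inr] <;> fun_prop
    have h2 : Dfn M (fun p : (Fin l → M) × (Fin k → M) =>
        ((∃ y, R p.1 y) ∧ p.2 = h p.1) ∨ ((¬ ∃ y, R p.1 y) ∧ p.2 = fun _ => c)) :=
      Dfn.or (Dfn.comp hd' h1) (Dfn.and (by fun_prop) (Dfn.eq (by fun_prop) (by fun_prop)))
    convert h2 using 3 with p
    by_cases hp : ∃ y, R p.1 y <;> simp [hp]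

end Language

/-! ### The monotonicity theorem. -/

section Monotone
variable {M : Type*} [LinearOrder M] [DefStr M]
  {D : Type*} [LinearOrder D] [DSp M D] [Line M D] [TopologicalSpace D] [OrderTopology D]
  [NoMinOrder D] [NoMaxOrder D] [DenselyOrdered D]
  {N : Type*} [LinearOrder N] [DSp M N] [Line M N] {f : D → N}

/-- Interval induction on `f x < f y`: the left germ at `s` carries the inequality to `s`, the right
germ carries it past `s`. -/
theorem strictMonoOn_of_germs (hf : Dfn M f) {a b : D}
    (h : ∀ x, a < x → x < b → (∀ᶠ y in 𝓝[>] x, f x < f y) ∧ (∀ᶠ y in 𝓝[<] x, f y < f x)) :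
    StrictMonoOn f (Ioo a b) := by
  intro x hx x' hx' hxx'
  refine interval_induction (M := M) (P := fun y => f x < f y) (by fun_prop) (h x hx.1 hx.2).1 ?_ ?_
    x' hxx' le_rfl
  · intro s h1 h2 h3
    obtain ⟨y, hy, hxy, hys⟩ := ((h s (hx.1.trans h1) (h2.trans_lt hx'.2)).2.and
      (Ioo_mem_nhdsLT h1)).exists
    exact (h3 y hxy hys).trans hy
  · intro s h1 h2 h3
    exact (h s (hx.1.trans h1) (h2.trans hx'.2)).1.mono fun y hy => h3.trans hy

theorem strictAntiOn_of_germs (hf : Dfn M f) {a b : D}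
    (h : ∀ x, a < x → x < b → (∀ᶠ y in 𝓝[>] x, f y < f x) ∧ (∀ᶠ y in 𝓝[<] x, f x < f y)) :
    StrictAntiOn f (Ioo a b) := by
  intro x hx x' hx' hxx'
  refine interval_induction (M := M) (P := fun y => f y < f x) (by fun_prop) (h x hx.1 hx.2).1 ?_ ?_
    x' hxx' le_rfl
  · intro s h1 h2 h3
    obtain ⟨y, hy, hxy, hys⟩ := ((h s (hx.1.trans h1) (h2.trans_lt hx'.2)).2.and
      (Ioo_mem_nhdsLT h1)).exists
    exact hy.trans (h3 y hxy hys)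
  · intro s h1 h2 h3
    exact (h s (hx.1.trans h1) (h2.trans hx'.2)).1.mono fun y hy => hy.trans h3

/-- The image is infinite and definable, so it contains a whole interval `[f c, f d]`; a monotone
function whose image fills a neighbourhood of its value is continuous there. -/
theorem exists_continuous_of_strictMonoOn [DenselyOrdered N] [NoMinOrder N] [NoMaxOrder N]
    [TopologicalSpace N] [OrderTopology N] (hf : Dfn M f) {a b : D} (hab : a < b)
    (h : StrictMonoOn f (Ioo a b)) :
    ∃ c d, a < c ∧ c < d ∧ d < b ∧ ∀ x ∈ Ioo c d, ContinuousAt f x := by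
  have heq : Dfn M (fun y => ∃ x, (a < x ∧ x < b) ∧ f x = y) :=
    Dfn.exists (Dfn.and (by fun_prop) (Dfn.eq (by fun_prop) (by fun_prop)))
  obtain ⟨u, v, huv, h1⟩ := exists_Icc_of_infinite heq ((Ioo_infinite hab).image h.injOn)
  obtain ⟨c, hc, rfl⟩ := h1 u le_rfl huv.le
  obtain ⟨d, hd, rfl⟩ := h1 v huv.le le_rfl
  refine ⟨c, d, hc.1, (h.lt_iff_lt hc hd).1 huv, hd.2, fun x hx => ?_⟩
  have hxI : x ∈ Ioo a b := ⟨hc.1.trans hx.1, hx.2.trans hd.2⟩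
  refine continuousAt_of_monotoneOn_of_image_mem_nhds h.monotoneOn (Ioo_mem_nhds hxI.1 hxI.2) ?_
  refine mem_of_superset (Ioo_mem_nhds (h hc hxI hx.1) (h hxI hd hx.2)) ?_
  intro y hy
  exact h1 y hy.1.le hy.2.le

/-- If all points are strict local minima, then for each `c` close to `b` the values of `f` near `b`
fall to at most `f c`. The place where they do so for good is a drop point `e > c`. Drop points thus
accumulate at `b`, and by o-minimality they fill an interval ending at `b`. -/
theorem exists_drop_of_local_min (hf : Dfn M f) {a b : D} (hab : a < b)
    (h : ∀ x, a < x → x < b → (∀ᶠ y in 𝓝[>] x, f x < f y) ∧ (∀ᶠ y in 𝓝[<] x, f x < f y)) :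
    ∃ u, a ≤ u ∧ u < b ∧ ∀ e, u < e → e < b →
      ∃ c, (∀ᶠ y in 𝓝[<] e, f c < f y) ∧ (∀ᶠ y in 𝓝[>] e, f y ≤ f c) := by
  -- shrink so that no point is a strict minimum of `f` on the right
  obtain ⟨a', haa', hab', hB⟩ : ∃ a', a ≤ a' ∧ a' < b ∧
      ∀ x, a' < x → x < b → ∃ y, x < y ∧ y < b ∧ f y ≤ f x := by
    have hd : Dfn M (fun x => ∀ y, x < y → y < b → f x < f y) :=
      Dfn.forall (Dfn.imp (by fun_prop) (Dfn.imp (by fun_prop) (by fun_prop)))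
    rcases eventually_nhdsLT_or_not hd b with h1 | h1
    · exfalso
      obtain ⟨u, hub, hu⟩ := eventually_nhdsLT_iff.1 h1
      obtain ⟨x, hx1, hx2⟩ := exists_between (max_lt hab hub)
      obtain ⟨hxa, hxu⟩ := max_lt_iff.1 hx1
      obtain ⟨y, hy, hy1, hy2⟩ := ((h x hxa hx2).2.and (Ioo_mem_nhdsLT hxu)).exists
      exact lt_asymm hy (hu y hy1 (hy2.trans hx2) x hy2 hx2)
    · obtain ⟨u, hub, hu⟩ := eventually_nhdsLT_iff.1 h1
      refine ⟨max a u, le_max_left _ _, max_lt hab hub, fun x hx1 hx2 => ?_⟩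
      have := hu x ((le_max_right _ _).trans_lt hx1) hx2
      push Not at this
      exact this
  replace h := fun x (hx : a' < x) => h x (haa'.trans_lt hx)
  -- near `b`, the function is below each of its values
  have hend : ∀ c, a' < c → c < b → ∀ᶠ y in 𝓝[<] b, f y ≤ f c := by
    intro c hac hcb
    refine (eventually_nhdsLT_or_not (P := fun y => f y ≤ f c) (M := M) (by fun_prop) b).resolve_right
      fun h1 => ?_
    obtain ⟨u, hub, hu⟩ := eventually_nhdsLT_iff.1 h1
    have hmem : (c ≤ max u c ∧ max u c < b) ∧ ∀ y, max u c < y → y < b → f c < f y :=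
      ⟨⟨le_max_right _ _, max_lt hub hcb⟩, fun y hy1 hy2 =>
        not_le.1 (hu y ((le_max_left _ _).trans_lt hy1) hy2)⟩
    -- Let `d` be the start of the longest tail on which `f` exceeds `f c`. The local minimum at `d`
    -- forces `f d ≤ f c`, as otherwise the tail would extend to the left. Then `f d` lies strictly
    -- below all later values, against `hB`.
    obtain ⟨d, hd⟩ := exists_isGLB (M := M)
      (P := fun d => (c ≤ d ∧ d < b) ∧ ∀ y, d < y → y < b → f c < f y)
      (Dfn.and (by fun_prop)
        (Dfn.forall (Dfn.imp (by fun_prop) (Dfn.imp (by fun_prop) (by fun_prop)))))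
      ⟨max u c, hmem⟩ ⟨c, fun y hy => hy.1.1⟩
    have hcd : c ≤ d := hd.2 fun y hy => hy.1.1
    have hdb : d < b := (hd.1 hmem).trans_lt hmem.1.2
    have hright : ∀ y, d < y → y < b → f c < f y := by
      intro y hdy hyb
      obtain ⟨w, hw, hwy⟩ := (isGLB_lt_iff hd).1 hdy
      exact hw.2 y hwy hyb
    have hfd : f d ≤ f c := by
      by_contra! hlt
      have hcd' : c < d := lt_of_le_of_ne hcd (by rintro rfl; exact lt_irrefl _ hlt)
      obtain ⟨w, hwd, hw⟩ := eventually_nhdsLT_iff.1 (h d (hac.trans hcd') hdb).2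
      have hmem' : (c ≤ max w c ∧ max w c < b) ∧ ∀ y, max w c < y → y < b → f c < f y := by
        refine ⟨⟨le_max_right _ _, max_lt (hwd.trans hdb) hcb⟩, fun y hy1 hy2 => ?_⟩
        rcases lt_trichotomy y d with h3 | rfl | h3
        · exact hlt.trans (hw y ((le_max_left _ _).trans_lt hy1) h3)
        · exact hlt
        · exact hright y h3 hy2
      exact absurd (hd.1 hmem') (not_le.2 (max_lt hwd hcd'))
    obtain ⟨y, hdy, hyb, hy⟩ := hB d (hac.trans_le hcd) hdb
    exact absurd (hright y hdy hyb) (not_lt.2 (hy.trans hfd))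
  have hdrop : ∀ c, a' < c → c < b → ∃ e, c < e ∧ e < b ∧
      (∀ᶠ y in 𝓝[<] e, f c < f y) ∧ (∀ᶠ y in 𝓝[>] e, f y ≤ f c) := by
    intro c hac hcb
    obtain ⟨u, hub, hu⟩ := eventually_nhdsLT_iff.1 (hend c hac hcb)
    have hmem : (c ≤ max u c ∧ max u c < b) ∧ ∀ y, max u c < y → y < b → f y ≤ f c :=
      ⟨⟨le_max_right _ _, max_lt hub hcb⟩, fun y hy1 hy2 =>
        hu y ((le_max_left _ _).trans_lt hy1) hy2⟩
    -- The start of the longest tail with `f ≤ f c` is the drop point. Just to its left `f` exceeds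
    -- `f c`, since otherwise the tail could be lengthened.
    obtain ⟨d, hd⟩ := exists_isGLB (M := M)
      (P := fun d => (c ≤ d ∧ d < b) ∧ ∀ y, d < y → y < b → f y ≤ f c)
      (Dfn.and (by fun_prop)
        (Dfn.forall (Dfn.imp (by fun_prop) (Dfn.imp (by fun_prop) (by fun_prop)))))
      ⟨max u c, hmem⟩ ⟨c, fun y hy => hy.1.1⟩
    have hcd : c ≤ d := hd.2 fun y hy => hy.1.1
    have hdb : d < b := (hd.1 hmem).trans_lt hmem.1.2
    have hright : ∀ y, d < y → y < b → f y ≤ f c := by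
      intro y hdy hyb
      obtain ⟨w, hw, hwy⟩ := (isGLB_lt_iff hd).1 hdy
      exact hw.2 y hwy hyb
    have hright' : ∀ᶠ y in 𝓝[>] d, f y ≤ f c :=
      (Ioo_mem_nhdsGT hdb : Ioo d b ∈ _) |> fun h3 => mem_of_superset h3 fun y hy => hright y hy.1 hy.2
    have hcd' : c < d := by
      refine lt_of_le_of_ne hcd ?_
      rintro rfl
      obtain ⟨y, hy1, hy2⟩ := ((h c hac hcb).1.and hright').exists
      exact absurd hy1 (not_lt.2 hy2)
    have hfd : f d ≤ f c := by
      obtain ⟨y, hy1, hy2⟩ := ((h d (hac.trans hcd') hdb).1.and hright').exists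
      exact hy1.le.trans hy2
    refine ⟨d, hcd', hdb, ?_, hright'⟩
    rcases eventually_nhdsLT_or_not (P := fun y => f y ≤ f c) (M := M) (by fun_prop) d with h3 | h3
    · exfalso
      obtain ⟨w, hwd, hw⟩ := eventually_nhdsLT_iff.1 h3
      have hmem' : (c ≤ max w c ∧ max w c < b) ∧ ∀ y, max w c < y → y < b → f y ≤ f c := by
        refine ⟨⟨le_max_right _ _, max_lt (hwd.trans hdb) hcb⟩, fun y hy1 hy2 => ?_⟩
        rcases lt_trichotomy y d with h3 | rfl | h3
        · exact hw y ((le_max_left _ _).trans_lt hy1) h3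
        · exact hfd
        · exact hright y h3 hy2
      exact absurd (hd.1 hmem') (not_le.2 (max_lt hwd hcd'))
    · exact h3.mono fun y hy => not_le.1 hy
  have hd : Dfn M (fun e => ∃ c, (∀ᶠ y in 𝓝[<] e, f c < f y) ∧ (∀ᶠ y in 𝓝[>] e, f y ≤ f c)) :=
    Dfn.exists (Dfn.and
      (Dfn.eventually_nhdsLT (R := fun (p : D × D) y => f p.2 < f y) (by fun_prop) (by fun_prop))
      (Dfn.eventually_nhdsGT (R := fun (p : D × D) y => f y ≤ f p.2) (by fun_prop) (by fun_prop)))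
  rcases eventually_nhdsLT_or_not hd b with h1 | h1
  · obtain ⟨u, hub, hu⟩ := eventually_nhdsLT_iff.1 h1
    exact ⟨max a u, le_max_left _ _, max_lt hab hub, fun e he1 he2 =>
      hu e ((le_max_right _ _).trans_lt he1) he2⟩
  · exfalso
    obtain ⟨u, hub, hu⟩ := eventually_nhdsLT_iff.1 h1
    obtain ⟨c, hc1, hc2⟩ := exists_between (max_lt hab' hub)
    obtain ⟨hac, huc⟩ := max_lt_iff.1 hc1
    obtain ⟨e, hce, heb, h3, h4⟩ := hdrop c hac hc2
    exact hu e (huc.trans hce) heb ⟨c, h3, h4⟩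

/-- Applying the drop lemma in both directions gives a point `e` where `f` drops from left to right
across some `f c` and from right to left across some `f c'`; then `f c < f c' < f c`. -/
theorem not_local_min (hf : Dfn M f) {a b : D} (hab : a < b) :
    ¬ ∀ x, a < x → x < b → (∀ᶠ y in 𝓝[>] x, f x < f y) ∧ (∀ᶠ y in 𝓝[<] x, f x < f y) := by
  intro h
  obtain ⟨u, hau, hub, hu⟩ := exists_drop_of_local_min hf hab h
  obtain ⟨w, hw1, hw2, hw⟩ := exists_drop_of_local_min (M := M)
    (f := fun x : Dᵒᵈ => f (OrderDual.ofDual x)) (by fun_prop)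
    (a := OrderDual.toDual b) (b := OrderDual.toDual u) hub
    (fun x hx1 hx2 => (h (OrderDual.ofDual x) (hau.trans_lt hx2) hx1).symm)
  have hw1' : OrderDual.ofDual w ≤ b := hw1
  have hw2' : u < OrderDual.ofDual w := hw2
  obtain ⟨e, he1, he2⟩ := exists_between hw2'
  obtain ⟨c, h1, h2⟩ := hu e he1 (he2.trans_le hw1')
  obtain ⟨c', h3, h4⟩ := hw (OrderDual.toDual e) he2 he1
  obtain ⟨y, hy1, hy2⟩ := (h1.and (show ∀ᶠ y in 𝓝[<] e, f y ≤ f (OrderDual.ofDual c') from h4)).exists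
  obtain ⟨z, hz1, hz2⟩ := (h2.and (show ∀ᶠ y in 𝓝[>] e, f (OrderDual.ofDual c') < f y from h3)).exists
  exact lt_irrefl _ (((hy1.trans_le hy2).trans hz2).trans_le hz1)

/-- A definable function is continuous and monotone or antitone on some subinterval. -/
theorem exists_continuous_monotone [DenselyOrdered N] [NoMinOrder N] [NoMaxOrder N]
    [TopologicalSpace N] [OrderTopology N] (hf : Dfn M f) {a b : D} (hab : a < b) :
    ∃ c d, a < c ∧ c < d ∧ d < b ∧ (∀ x ∈ Ioo c d, ContinuousAt f x) ∧
      (MonotoneOn f (Ioo c d) ∨ AntitoneOn f (Ioo c d)) := by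
  have hconst : ∀ c d, a ≤ c → c < d → d ≤ b → (∀ x ∈ Ioo c d, ∀ y ∈ Ioo c d, f x = f y) →
      ∃ c d, a < c ∧ c < d ∧ d < b ∧ (∀ x ∈ Ioo c d, ContinuousAt f x) ∧
      (MonotoneOn f (Ioo c d) ∨ AntitoneOn f (Ioo c d)) := by
    intro c d hac hcd hdb h
    obtain ⟨p, hcp, hpd⟩ := exists_between hcd
    obtain ⟨q, hpq, hqd⟩ := exists_between hpd
    have h' : ∀ x ∈ Ioo p q, x ∈ Ioo c d := fun x hx => ⟨hcp.trans hx.1, hx.2.trans hqd⟩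
    refine ⟨p, q, hac.trans_lt hcp, hpq, hqd.trans_le hdb, fun x hx => ?_,
      Or.inl fun x hx y hy _ => (h x (h' x hx) y (h' y hy)).le⟩
    refine (continuousAt_const (y := f x)).congr ?_
    exact mem_of_superset (Ioo_mem_nhds hx.1 hx.2) fun y hy => h x (h' x hx) y (h' y hy)
  have hmono : ∀ c d, a < c → c < d → d < b → (StrictMonoOn f (Ioo c d) ∨ StrictAntiOn f (Ioo c d)) →
      ∃ c d, a < c ∧ c < d ∧ d < b ∧ (∀ x ∈ Ioo c d, ContinuousAt f x) ∧
      (MonotoneOn f (Ioo c d) ∨ AntitoneOn f (Ioo c d)) := by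
    intro c d hac hcd hdb h
    rcases h with h | h
    · obtain ⟨p, q, hcp, hpq, hqd, hc⟩ := exists_continuous_of_strictMonoOn hf hcd h
      exact ⟨p, q, hac.trans hcp, hpq, hqd.trans hdb, hc,
        Or.inl (h.monotoneOn.mono (Ioo_subset_Ioo hcp.le hqd.le))⟩
    · obtain ⟨p, q, hcp, hpq, hqd, hc⟩ := exists_continuous_of_strictMonoOn (M := M)
        (f := fun x => OrderDual.toDual (f x)) (by fun_prop) hcd h
      exact ⟨p, q, hac.trans hcp, hpq, hqd.trans hdb, fun x hx => hc x hx,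
        Or.inr (h.antitoneOn.mono (Ioo_subset_Ioo hcp.le hqd.le))⟩
  -- the germs of `f` at a point compared with its value there
  have d1 : Dfn M (fun x => ∀ᶠ y in 𝓝[>] x, f x < f y) :=
    Dfn.eventually_nhdsGT (R := fun x y => f x < f y) (by fun_prop) (by fun_prop)
  have d2 : Dfn M (fun x => ∀ᶠ y in 𝓝[>] x, f y < f x) :=
    Dfn.eventually_nhdsGT (R := fun x y => f y < f x) (by fun_prop) (by fun_prop)
  have d3 : Dfn M (fun x => ∀ᶠ y in 𝓝[<] x, f x < f y) :=
    Dfn.eventually_nhdsLT (R := fun x y => f x < f y) (by fun_prop) (by fun_prop)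
  have d4 : Dfn M (fun x => ∀ᶠ y in 𝓝[<] x, f y < f x) :=
    Dfn.eventually_nhdsLT (R := fun x y => f y < f x) (by fun_prop) (by fun_prop)
  obtain ⟨a1, b1, ha1, hab1, hb1, h1⟩ := exists_Icc_or_not d1 hab
  obtain ⟨a2, b2, ha2, hab2, hb2, h2⟩ := exists_Icc_or_not d2 hab1
  obtain ⟨a3, b3, ha3, hab3, hb3, h3⟩ := exists_Icc_or_not d3 hab2
  obtain ⟨a4, b4, ha4, hab4, hb4, h4⟩ := exists_Icc_or_not d4 hab3
  have ha : a < a4 := ha1.trans (ha2.trans (ha3.trans ha4))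
  have hb : b4 < b := hb4.trans (hb3.trans (hb2.trans hb1))
  replace h1 := h1.imp (fun h x (hx : a4 < x) (hx' : x < b4) => h x ((ha2.trans (ha3.trans ha4)).trans hx).le
    (hx'.trans (hb4.trans (hb3.trans hb2))).le)
    (fun h x (hx : a4 < x) (hx' : x < b4) => h x ((ha2.trans (ha3.trans ha4)).trans hx).le
    (hx'.trans (hb4.trans (hb3.trans hb2))).le)
  replace h2 := h2.imp (fun h x (hx : a4 < x) (hx' : x < b4) => h x ((ha3.trans ha4).trans hx).le
    (hx'.trans (hb4.trans hb3)).le)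
    (fun h x (hx : a4 < x) (hx' : x < b4) => h x ((ha3.trans ha4).trans hx).le
    (hx'.trans (hb4.trans hb3)).le)
  replace h3 := h3.imp (fun h x (hx : a4 < x) (hx' : x < b4) => h x (ha4.trans hx).le
    (hx'.trans hb4).le)
    (fun h x (hx : a4 < x) (hx' : x < b4) => h x (ha4.trans hx).le
    (hx'.trans hb4).le)
  replace h4 := h4.imp (fun h x (hx : a4 < x) (hx' : x < b4) => h x hx.le hx'.le)
    (fun h x (hx : a4 < x) (hx' : x < b4) => h x hx.le hx'.le)
  obtain ⟨x, hx1, hx2⟩ := exists_between hab4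
  -- A one-sided germ that is neither above nor below the value at the point equals it, so `f` is
  -- constant on an interval beside `x`.
  have heqR : (∀ y, a4 < y → y < b4 → ¬ ∀ᶠ z in 𝓝[>] y, f y < f z) →
      (∀ y, a4 < y → y < b4 → ¬ ∀ᶠ z in 𝓝[>] y, f z < f y) →
      ∃ v, x < v ∧ v ≤ b4 ∧ ∀ y, x < y → y < v → f y = f x := by
    intro h5 h6
    have h5 := (eventually_nhdsGT_or_not (M := M) (P := fun z => f x < f z) (by fun_prop)
      x).resolve_left (h5 x hx1 hx2)
    have h6 := (eventually_nhdsGT_or_not (M := M) (P := fun z => f z < f x) (by fun_prop)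
      x).resolve_left (h6 x hx1 hx2)
    obtain ⟨v, hv, h7⟩ := eventually_nhdsGT_iff.1 (h5.and h6)
    exact ⟨min v b4, lt_min hv hx2, min_le_right _ _, fun y hy1 hy2 =>
      le_antisymm (not_lt.1 (h7 y hy1 (hy2.trans_le (min_le_left _ _))).1)
        (not_lt.1 (h7 y hy1 (hy2.trans_le (min_le_left _ _))).2)⟩
  have heqL : (∀ y, a4 < y → y < b4 → ¬ ∀ᶠ z in 𝓝[<] y, f y < f z) →
      (∀ y, a4 < y → y < b4 → ¬ ∀ᶠ z in 𝓝[<] y, f z < f y) →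
      ∃ v, a4 ≤ v ∧ v < x ∧ ∀ y, v < y → y < x → f y = f x := by
    intro h5 h6
    have h5 := (eventually_nhdsLT_or_not (M := M) (P := fun z => f x < f z) (by fun_prop)
      x).resolve_left (h5 x hx1 hx2)
    have h6 := (eventually_nhdsLT_or_not (M := M) (P := fun z => f z < f x) (by fun_prop)
      x).resolve_left (h6 x hx1 hx2)
    obtain ⟨v, hv, h7⟩ := eventually_nhdsLT_iff.1 (h5.and h6)
    exact ⟨max v a4, le_max_right _ _, max_lt hv hx1, fun y hy1 hy2 =>
      le_antisymm (not_lt.1 (h7 y ((le_max_left _ _).trans_lt hy1) hy2).1)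
        (not_lt.1 (h7 y ((le_max_left _ _).trans_lt hy1) hy2).2)⟩
  have hR : ((∀ y, a4 < y → y < b4 → ¬ ∀ᶠ z in 𝓝[>] y, f y < f z) ∧
      ∀ y, a4 < y → y < b4 → ¬ ∀ᶠ z in 𝓝[>] y, f z < f y) → ∃ c d, a < c ∧ c < d ∧ d < b ∧
      (∀ x ∈ Ioo c d, ContinuousAt f x) ∧ (MonotoneOn f (Ioo c d) ∨ AntitoneOn f (Ioo c d)) := fun h => by
    obtain ⟨v, hxv, hvb, h7⟩ := heqR h.1 h.2
    exact hconst x v (ha.trans hx1).le hxv (hvb.trans hb.le) fun y hy z hz =>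
      (h7 y hy.1 hy.2).trans (h7 z hz.1 hz.2).symm
  have hL : ((∀ y, a4 < y → y < b4 → ¬ ∀ᶠ z in 𝓝[<] y, f y < f z) ∧
      ∀ y, a4 < y → y < b4 → ¬ ∀ᶠ z in 𝓝[<] y, f z < f y) → ∃ c d, a < c ∧ c < d ∧ d < b ∧
      (∀ x ∈ Ioo c d, ContinuousAt f x) ∧ (MonotoneOn f (Ioo c d) ∨ AntitoneOn f (Ioo c d)) := fun h => by
    obtain ⟨v, hav, hvx, h7⟩ := heqL h.1 h.2
    exact hconst v x (ha.le.trans hav) hvx (hx2.trans hb).le fun y hy z hz =>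
      (h7 y hy.1 hy.2).trans (h7 z hz.1 hz.2).symm
  -- Germs both above or both below contradict `not_local_min`, opposite strict germs give strict
  -- monotonicity, and in the remaining cases `f` is constant on some interval.
  rcases h1 with h1 | h1
  · rcases h3 with h3 | h3
    · exact absurd (fun y hy1 hy2 => ⟨h1 y hy1 hy2, h3 y hy1 hy2⟩) (not_local_min hf hab4)
    · rcases h4 with h4 | h4
      · exact hmono a4 b4 ha hab4 hb (Or.inl (strictMonoOn_of_germs hf
          fun y hy1 hy2 => ⟨h1 y hy1 hy2, h4 y hy1 hy2⟩))
      · exact hL ⟨h3, h4⟩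
  · rcases h2 with h2 | h2
    · rcases h3 with h3 | h3
      · exact hmono a4 b4 ha hab4 hb (Or.inr (strictAntiOn_of_germs hf
          fun y hy1 hy2 => ⟨h2 y hy1 hy2, h3 y hy1 hy2⟩))
      · rcases h4 with h4 | h4
        · exact absurd (fun y hy1 hy2 => ⟨h2 y hy1 hy2, h4 y hy1 hy2⟩)
            (not_local_min (M := M) (f := fun x => OrderDual.toDual (f x)) (by fun_prop) hab4)
        · exact hL ⟨h3, h4⟩
    · exact hR ⟨h1, h2⟩

end Monotone

/-! ### Definability of topological conditions. -/

/-- A space over `M` whose topology has a uniformly definable basis. -/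
class DTop (M : Type*) [LinearOrder M] [DefStr M] (X : Type*) [DSp M X] [TopologicalSpace X] :
    Prop extends RSp M X where
  basis : ∃ (ι : Type) (_ : Finite ι) (B : (ι → M) → X → Prop),
    Dfn M (fun p : (ι → M) × X => B p.1 p.2) ∧
      ∀ x, (𝓝 x).HasBasis (fun q => B q x) (fun q => {y | B q y})

section DTop
variable {M : Type*} [LinearOrder M] [DefStr M]
variable {X Y Z : Type*} [DSp M X] [DSp M Y] [DSp M Z] [TopologicalSpace X] [TopologicalSpace Y]
  [DTop M X] [DTop M Y]

/-- A definable basis indexed by a power of `M` makes quantification over neighbourhoods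
first-order. -/
theorem Dfn.eventually_nhds {R : Z → X → Prop} (hR : Dfn M (fun p : Z × X => R p.1 p.2))
    {g : Z → X} (hg : Dfn M g) : Dfn M (fun z => ∀ᶠ y in 𝓝 (g z), R z y) := by
  obtain ⟨ι, _, B, hB, hbas⟩ := DTop.basis (M := M) (X := X)
  have : Dfn M (fun z => ∃ q, B q (g z) ∧ ∀ y, B q y → R z y) :=
    Dfn.exists (Dfn.and (by fun_prop) (Dfn.forall (Dfn.imp (by fun_prop) (by fun_prop))))
  simpa only [(hbas _).eventually_iff, Set.mem_ofPred_eq] using this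

theorem Dfn.continuousAt {f : Z → X → Y} (hf : Dfn M (fun p : Z × X => f p.1 p.2))
    {g : Z → X} (hg : Dfn M g) : Dfn M (fun z => ContinuousAt (f z) (g z)) := by
  obtain ⟨ι, _, B, hB, hbas⟩ := DTop.basis (M := M) (X := Y)
  have : Dfn M (fun z => ∀ q, B q (f z (g z)) → ∀ᶠ y in 𝓝 (g z), B q (f z y)) :=
    Dfn.forall (Dfn.imp (by fun_prop) (Dfn.eventually_nhds
      (R := fun (p : Z × (ι → M)) y => B p.2 (f p.1 y)) (by fun_prop) (by fun_prop)))
  simpa only [ContinuousAt, (hbas _).tendsto_right_iff, Set.mem_ofPred_eq] using this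

variable [OMinSk M] [TopologicalSpace M] [OrderTopology M] [NoMinOrder M] [NoMaxOrder M]
  [DenselyOrdered M]

instance : DTop M M where
  basis := by
    refine ⟨Bool, inferInstance, fun q x => q false < x ∧ x < q true, by fun_prop, fun x => ⟨fun s => ?_⟩⟩
    rw [mem_nhds_iff_exists_Ioo_subset]
    constructor
    · rintro ⟨l, u, hx, h⟩
      exact ⟨fun b => cond b u l, hx, h⟩
    · rintro ⟨q, hx, h⟩
      exact ⟨_, _, hx, h⟩

instance {κ : Type} [Finite κ] : DTop M (κ → M) where
  basis := by
    refine ⟨κ × Bool, inferInstance, fun q x => ∀ i, q (i, false) < x i ∧ x i < q (i, true),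
      Dfn.forall_fin fun i => by fun_prop, fun x => ⟨fun s => ?_⟩⟩
    constructor
    · intro hs
      rw [nhds_pi, Filter.mem_pi] at hs
      obtain ⟨I, -, t, ht, hts⟩ := hs
      have := fun i => mem_nhds_iff_exists_Ioo_subset.1 (ht i)
      choose l u hx h using this
      exact ⟨fun p => cond p.2 (u p.1) (l p.1), hx, fun y hy => hts fun i _ => h i (hy i)⟩
    · rintro ⟨q, hx, h⟩
      have hx' : x ∈ {y : κ → M | ∀ i, q (i, false) < y i ∧ y i < q (i, true)} := hx
      refine mem_of_superset (IsOpen.mem_nhds ?_ hx') h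
      have : {y : κ → M | ∀ i, q (i, false) < y i ∧ y i < q (i, true)} =
          univ.pi fun i => Ioo (q (i, false)) (q (i, true)) := by
        ext y; simp
      rw [this]
      exact isOpen_set_pi finite_univ fun i _ => isOpen_Ioo

end DTop

section Cofinite
variable {M : Type*} [LinearOrder M] [DefStr M] [OMinSk M] [TopologicalSpace M] [OrderTopology M]
  [NoMinOrder M] [NoMaxOrder M] [DenselyOrdered M]

/-- An infinite definable set of exceptions would contain an interval. -/
theorem eventually_cofinite_of_dense {P : M → Prop} (hP : Dfn M P)
    (h : ∀ a b, a < b → ∃ x, a < x ∧ x < b ∧ P x) : ∀ᶠ x in cofinite, P x := by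
  rw [eventually_cofinite]
  by_contra hinf
  obtain ⟨a, b, hab, h1⟩ := exists_Icc_of_infinite (M := M) (P := fun x => ¬ P x) (by fun_prop) hinf
  obtain ⟨x, hax, hxb, hx⟩ := h a b hab
  exact h1 x hax.le hxb.le hx

theorem eventually_cofinite_continuousAt {f : M → M} (hf : Dfn M f) :
    ∀ᶠ x in cofinite, ContinuousAt f x := by
  refine eventually_cofinite_of_dense (Dfn.continuousAt (f := fun (_ : M) => f) (by fun_prop)
    (by fun_prop)) fun a b hab => ?_
  obtain ⟨c, d, hac, hcd, hdb, h, -⟩ := exists_continuous_monotone hf hab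
  obtain ⟨x, hx⟩ := exists_between hcd
  exact ⟨x, hac.trans hx.1, hx.2.trans hdb, h x hx⟩

end Cofinite

/-! ### Generic continuity in several variables. -/

/-- The definable subsets of `X` have nowhere dense frontier, and the definable functions `X → M`
are continuous at a dense set of points. -/
structure Tame (M : Type*) [LinearOrder M] [DefStr M] [TopologicalSpace M]
    (X : Type*) [DSp M X] [TopologicalSpace X] : Prop where
  const_on : ∀ {P : X → Prop}, Dfn M P → ∀ {U : Set X}, IsOpen U → U.Nonempty →
    ∃ V ⊆ U, IsOpen V ∧ V.Nonempty ∧ ((∀ x ∈ V, P x) ∨ ∀ x ∈ V, ¬ P x)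
  continuousAt : ∀ {f : X → M}, Dfn M f → ∀ {U : Set X}, IsOpen U → U.Nonempty →
    ∃ x ∈ U, ContinuousAt f x

section Tame
variable {M : Type*} [LinearOrder M] [DefStr M] [OMinSk M] [TopologicalSpace M] [OrderTopology M]
  [NoMinOrder M] [NoMaxOrder M] [DenselyOrdered M]
  {X Y : Type*} [DSp M X] [DSp M Y] [TopologicalSpace X] [TopologicalSpace Y]

theorem Tame.of_homeomorph (hX : Tame M X) (e : X ≃ₜ Y) (he : Dfn M e) : Tame M Y where
  const_on {P} hP U hU hne := by
    obtain ⟨V, hVU, hV, hVne, h⟩ := hX.const_on (P := fun x => P (e x)) (by fun_prop)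
      (hU.preimage e.continuous) (hne.preimage e.surjective)
    refine ⟨e '' V, image_subset_iff.2 hVU, e.isOpenMap V hV, hVne.image e, ?_⟩
    simpa only [forall_mem_image] using h
  continuousAt {f} hf U hU hne := by
    obtain ⟨x, hx, hc⟩ := hX.continuousAt (f := fun x => f (e x)) (by fun_prop)
      (hU.preimage e.continuous) (hne.preimage e.surjective)
    refine ⟨e x, hx, ?_⟩
    have := ContinuousAt.comp (g := fun x => f (e x)) (f := e.symm) (x := e x)
      (by simpa using hc) e.symm.continuous.continuousAt
    simpa [Function.comp_def] using this

variable [DTop M X]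

/-- Continuity at a point is itself a definable predicate, so it is constant on a smaller open set;
it cannot fail everywhere there. -/
theorem Tame.exists_continuousOn (hX : Tame M X) {f : X → M} (hf : Dfn M f) {U : Set X}
    (hU : IsOpen U) (hne : U.Nonempty) :
    ∃ V ⊆ U, IsOpen V ∧ V.Nonempty ∧ ∀ x ∈ V, ContinuousAt f x := by
  obtain ⟨V, hVU, hV, hVne, h | h⟩ := hX.const_on
    (Dfn.continuousAt (f := fun (_ : X) => f) (by fun_prop) Dfn.id) hU hne
  · exact ⟨V, hVU, hV, hVne, h⟩
  · obtain ⟨x, hx, hc⟩ := hX.continuousAt hf hV hVne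
    exact absurd hc (h x hx)

/-- If for each `x` in an open set a property inherited by subintervals holds for some interval,
then it holds for one interval and all `x` in some smaller open set. -/
theorem Tame.exists_uniform_interval (hX : Tame M X) {R : X → M → M → Prop}
    (hR : Dfn M (fun p : X × M × M => R p.1 p.2.1 p.2.2))
    (hmono : ∀ x a b a' b', R x a b → a ≤ a' → a' < b' → b' ≤ b → R x a' b')
    {U : Set X} (hU : IsOpen U) (hne : U.Nonempty) (h : ∀ x ∈ U, ∃ a b, a < b ∧ R x a b) :
    ∃ V ⊆ U, IsOpen V ∧ V.Nonempty ∧ ∃ c d, c < d ∧ ∀ x ∈ V, R x c d := by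
  obtain ⟨g, hg, hgR⟩ := skolem (M := M) (X := X) (Y := M × M)
    (R := fun x p => p.1 < p.2 ∧ R x p.1 p.2) (by fun_prop)
  obtain ⟨V1, hV1U, hV1, hne1, hc1⟩ := hX.exists_continuousOn (f := fun x => (g x).1) (by fun_prop)
    hU hne
  obtain ⟨x, hx, hc2⟩ := hX.continuousAt (f := fun x => (g x).2) (by fun_prop) hV1 hne1
  have hgU : ∀ x ∈ U, (g x).1 < (g x).2 ∧ R x (g x).1 (g x).2 := fun x hx =>
    hgR x ((h x hx).elim fun a ⟨b, hab⟩ => ⟨(a, b), hab⟩)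
  -- Both chosen endpoints are continuous at `x`, so an interval strictly inside the one chosen at
  -- `x` remains inside those chosen at nearby points.
  obtain ⟨c, hac, hcb⟩ := exists_between (hgU x (hV1U hx)).1
  obtain ⟨d, hcd, hdb⟩ := exists_between hcb
  have hev : ∀ᶠ y in 𝓝 x, (g y).1 < c ∧ d < (g y).2 ∧ y ∈ U :=
    ((hc1 x hx).eventually (eventually_lt_nhds hac)).and
      ((hc2.eventually (eventually_gt_nhds hdb)).and (hU.mem_nhds (hV1U hx)))
  obtain ⟨V, hV, hVo, hxV⟩ := mem_nhds_iff.1 hev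
  exact ⟨V, fun y hy => (hV hy).2.2, hVo, ⟨x, hxV⟩, c, d, hcd, fun y hy =>
    hmono y _ _ c d (hgU y (hV hy).2.2).2 (hV hy).1.le hcd (hV hy).2.1.le⟩

theorem exists_box {U : Set (X × M)} (hU : IsOpen U) (hne : U.Nonempty) :
    ∃ V : Set X, IsOpen V ∧ V.Nonempty ∧ ∃ a b : M, a < b ∧ ∀ x ∈ V, ∀ t, a < t → t < b → (x, t) ∈ U := by
  obtain ⟨⟨x, t⟩, hxt⟩ := hne
  obtain ⟨V, T, hV, hT, hxV, htT, h⟩ := isOpen_prod_iff.1 hU x t hxt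
  obtain ⟨a, b, ht, hab⟩ := mem_nhds_iff_exists_Ioo_subset.1 (hT.mem_nhds htT)
  exact ⟨V, hV, ⟨x, hxV⟩, a, b, ht.1.trans ht.2, fun y hy s h1 h2 => h ⟨hy, hab ⟨h1, h2⟩⟩⟩

theorem Tame.exists_box_of_fibers (hX : Tame M X) {P : X × M → Prop} (hP : Dfn M P)
    {U : Set X} (hU : IsOpen U) (hne : U.Nonempty) {a b : M}
    (h : ∀ x ∈ U, ∃ c d, a < c ∧ c < d ∧ d < b ∧ ∀ t, c ≤ t → t ≤ d → P (x, t)) :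
    ∃ V ⊆ U, IsOpen V ∧ V.Nonempty ∧ ∃ c d, c < d ∧ a < c ∧ d < b ∧
      ∀ x ∈ V, ∀ t, c ≤ t → t ≤ d → P (x, t) := by
  obtain ⟨V, hVU, hV, hVne, c, d, hcd, hR⟩ := hX.exists_uniform_interval
    (R := fun x c d => a < c ∧ d < b ∧ ∀ t, c ≤ t → t ≤ d → P (x, t))
    (Dfn.and (by fun_prop) (Dfn.and (by fun_prop)
      (Dfn.forall (Dfn.imp (by fun_prop) (Dfn.imp (by fun_prop) (by fun_prop))))))
    (fun x c d c' d' ⟨h1, h2, h3⟩ hc hcd hd => ⟨h1.trans_le hc, hd.trans_lt h2,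
      fun t ht1 ht2 => h3 t (hc.trans ht1) (ht2.trans hd)⟩) hU hne
    (fun x hx => by
      obtain ⟨c, d, h1, h2, h3, h4⟩ := h x hx
      exact ⟨c, d, h2, h1, h3, h4⟩)
  obtain ⟨x, hx⟩ := hVne
  exact ⟨V, hVU, hV, ⟨x, hx⟩, c, d, hcd, (hR x hx).1, (hR x hx).2.1, fun x hx => (hR x hx).2.2⟩

/-- After shrinking the base, either every fibre of `P` contains an interval inside `(a, b)`, or
none does and every fibre of `¬ P` contains one. In each case a common interval gives a box. -/
theorem Tame.const_on_prod (hX : Tame M X) {P : X × M → Prop} (hP : Dfn M P) {U : Set (X × M)}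
    (hU : IsOpen U) (hne : U.Nonempty) :
    ∃ V ⊆ U, IsOpen V ∧ V.Nonempty ∧ ((∀ x ∈ V, P x) ∨ ∀ x ∈ V, ¬ P x) := by
  obtain ⟨W, hW, hWne, a, b, hab, hbox⟩ := exists_box hU hne
  obtain ⟨V, hVW, hV, hVne, h⟩ := hX.const_on (P := fun x =>
    ∃ c d, a < c ∧ c < d ∧ d < b ∧ ∀ t, c ≤ t → t ≤ d → P (x, t))
    (Dfn.exists (Dfn.exists (Dfn.and (by fun_prop) (Dfn.and (by fun_prop) (Dfn.and (by fun_prop)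
      (Dfn.forall (Dfn.imp (by fun_prop) (Dfn.imp (by fun_prop) (by fun_prop))))))))) hW hWne
  rcases h with h | h
  · obtain ⟨V', hV'V, hV', ⟨x, hx⟩, c, d, hcd, hac, hdb, h'⟩ := hX.exists_box_of_fibers hP hV hVne h
    obtain ⟨t, ht⟩ := exists_between hcd
    exact ⟨V' ×ˢ Ioo c d, fun p hp => hbox p.1 (hVW (hV'V hp.1)) p.2 (hac.trans hp.2.1)
      (hp.2.2.trans hdb), hV'.prod isOpen_Ioo, ⟨(x, t), hx, ht⟩,
      Or.inl fun p hp => h' p.1 hp.1 p.2 hp.2.1.le hp.2.2.le⟩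
  · obtain ⟨V', hV'V, hV', ⟨x, hx⟩, c, d, hcd, hac, hdb, h'⟩ := hX.exists_box_of_fibers
      (P := fun p => ¬ P p) (by fun_prop) hV hVne (a := a) (b := b) (fun x hx => by
        obtain ⟨c, d, h1, h2, h3, h4 | h4⟩ := exists_Icc_or_not (M := M)
          (P := fun t => P (x, t)) (by fun_prop) hab
        · exact absurd ⟨c, d, h1, h2, h3, h4⟩ (h x hx)
        · exact ⟨c, d, h1, h2, h3, h4⟩)
    obtain ⟨t, ht⟩ := exists_between hcd
    exact ⟨V' ×ˢ Ioo c d, fun p hp => hbox p.1 (hVW (hV'V hp.1)) p.2 (hac.trans hp.2.1)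
      (hp.2.2.trans hdb), hV'.prod isOpen_Ioo, ⟨(x, t), hx, ht⟩,
      Or.inr fun p hp => h' p.1 hp.1 p.2 hp.2.1.le hp.2.2.le⟩

/-- The value of `φ` at a point of an interval lies between the values at the
endpoints. -/
def BetweenOn {M N : Type*} [LinearOrder M] [LinearOrder N] (φ : M → N) (c d : M) : Prop :=
  ∀ s t u, c < s → s ≤ t → t ≤ u → u < d → (φ s ≤ φ t ∧ φ t ≤ φ u) ∨ (φ u ≤ φ t ∧ φ t ≤ φ s)

/-- For `s < t < u` close together, the values `f (y, r)` with `r` in `[s, u]` lie between `f (y,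
s)` and `f (y, u)`, and these are controlled by continuity in `y` alone. Betweenness, unlike
monotonicity, does not fix a direction, which may vary with `y`. -/
theorem continuousAt_of_betweenOn {f : X × M → M} {x : X} {t c d : M} (hct : c < t) (htd : t < d)
    {V : Set X} (hV : V ∈ 𝓝 x)
    (hbtw : ∀ y ∈ V, BetweenOn (fun t => f (y, t)) c d)
    (h1 : ContinuousAt (fun t => f (x, t)) t)
    (h2 : ∀ s, c < s → s < d → ContinuousAt (fun y => f (y, s)) x) : ContinuousAt f (x, t) := by
  have key : ∀ (P : M → Prop), (∀ᶠ z in 𝓝 (f (x, t)), P z) → (∀ᶠ z in 𝓝 (f (x, t)), ∀ᶠ w in 𝓝 z, P w) →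
      (∀ u v w, (u ≤ v ∧ v ≤ w) ∨ (w ≤ v ∧ v ≤ u) → P u → P w → P v) →
      ∀ᶠ p in 𝓝 (x, t), P (f p) := by
    intro P hP hP' hconv
    have h3 : ∀ᶠ s in 𝓝 t, (∀ᶠ w in 𝓝 (f (x, s)), P w) ∧ c < s ∧ s < d :=
      (h1.eventually hP').and (Ioo_mem_nhds hct htd)
    obtain ⟨a, b, hat, htb, hab⟩ := eventually_nhds_iff_Ioo.1 h3
    obtain ⟨s, has, hst⟩ := exists_between hat
    obtain ⟨u, htu, hub⟩ := exists_between htb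
    obtain ⟨hs, hcs, hsd⟩ := hab s has (hst.trans htb)
    obtain ⟨hu, hcu, hud⟩ := hab u (hat.trans htu) hub
    have h4 : ∀ᶠ y in 𝓝 x, y ∈ V ∧ P (f (y, s)) ∧ P (f (y, u)) :=
      (eventually_mem_set.2 hV).and (((h2 s hcs hsd).eventually hs).and ((h2 u hcu hud).eventually hu))
    rw [nhds_prod_eq]
    filter_upwards [h4.prod_mk (Ioo_mem_nhds hst htu : ∀ᶠ z in 𝓝 t, z ∈ Ioo s u)] with p hp
    exact hconv _ _ _ (hbtw p.1 hp.1.1 s p.2 u hcs hp.2.1.le hp.2.2.le hud) hp.1.2.1 hp.1.2.2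
  rw [ContinuousAt, tendsto_order]
  constructor
  · intro l hl
    refine key (fun z => l < z) (eventually_gt_nhds hl)
      ((eventually_gt_nhds hl).mono fun z hz => eventually_gt_nhds hz) ?_
    rintro u v w (h | h) hu hw
    exacts [hu.trans_le h.1, hw.trans_le h.1]
  · intro l hl
    refine key (fun z => z < l) (eventually_lt_nhds hl)
      ((eventually_lt_nhds hl).mono fun z hz => eventually_lt_nhds hz) ?_
    rintro u v w (h | h) hu hw
    exacts [h.2.trans_lt hw, h.2.trans_lt hu]

/-- The monotonicity theorem on fibres, made uniform over an open base, gives continuity and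
betweenness in the last variable. Continuity in the base variable holds on a box by `const_on_prod`,
and `continuousAt_of_betweenOn` combines the two. -/
theorem Tame.continuousAt_prod (hX : Tame M X) {f : X × M → M} (hf : Dfn M f) {U : Set (X × M)}
    (hU : IsOpen U) (hne : U.Nonempty) : ∃ p ∈ U, ContinuousAt f p := by
  obtain ⟨W, hW, hWne, a, b, hab, hbox⟩ := exists_box hU hne
  obtain ⟨V, hVW, hV, hVne, c, d, hcd, h⟩ := hX.exists_uniform_interval
    (R := fun x c d => (a ≤ c ∧ d ≤ b) ∧ (∀ t, c < t → t < d → ContinuousAt (fun t => f (x, t)) t) ∧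
      BetweenOn (fun t => f (x, t)) c d)
    (by
      refine Dfn.and (by fun_prop) (Dfn.and (Dfn.forall (Dfn.imp (by fun_prop) (Dfn.imp (by fun_prop)
        (Dfn.continuousAt (f := fun (p : (X × M × M) × M) t => f (p.1.1, t)) (by fun_prop)
          (by fun_prop))))) ?_)
      unfold BetweenOn
      exact Dfn.forall (Dfn.forall (Dfn.forall (Dfn.imp (by fun_prop) (Dfn.imp (by fun_prop)
        (Dfn.imp (by fun_prop) (Dfn.imp (by fun_prop) (by fun_prop)))))))
      )
    (fun x c d c' d' ⟨h1, h2, h3⟩ hc hcd hd => ⟨⟨h1.1.trans hc, hd.trans h1.2⟩,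
      fun t ht1 ht2 => h2 t (hc.trans_lt ht1) (ht2.trans_le hd),
      fun s t u h4 h5 h6 h7 => h3 s t u (hc.trans_lt h4) h5 h6 (h7.trans_le hd)⟩) hW hWne
    (fun x hx => by
      obtain ⟨c, d, h1, h2, h3, h4, h5⟩ := exists_continuous_monotone (M := M)
        (f := fun t => f (x, t)) (by fun_prop) hab
      refine ⟨c, d, h2, ⟨h1.le, h3.le⟩, fun t ht1 ht2 => h4 t ⟨ht1, ht2⟩, ?_⟩
      intro s t u hcs hst htu hud
      have hs : s ∈ Ioo c d := ⟨hcs, (hst.trans htu).trans_lt hud⟩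
      have ht : t ∈ Ioo c d := ⟨hcs.trans_le hst, htu.trans_lt hud⟩
      have hu : u ∈ Ioo c d := ⟨hcs.trans_le (hst.trans htu), hud⟩
      exact h5.imp (fun h => ⟨h hs ht hst, h ht hu htu⟩) (fun h => ⟨h ht hu htu, h hs ht hst⟩))
  obtain ⟨x0, hx0⟩ := hVne
  obtain ⟨t0, ht0⟩ := exists_between hcd
  obtain ⟨V', hV'V, hV', hne', h'⟩ := hX.const_on_prod
    (P := fun p => ContinuousAt (fun y => f (y, p.2)) p.1)
    (Dfn.continuousAt (f := fun (p : X × M) y => f (y, p.2)) (by fun_prop) (by fun_prop))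
    (hV.prod (isOpen_Ioo (a := c) (b := d))) ⟨(x0, t0), hx0, ht0⟩
  obtain ⟨T, hT, hTne, c', d', hcd', hbox'⟩ := exists_box hV' hne'
  obtain ⟨t, ht⟩ := exists_between hcd'
  have hcont : ∀ x ∈ T, ∀ t, c' < t → t < d' → ContinuousAt (fun y => f (y, t)) x := by
    rcases h' with h' | h'
    · exact fun x hx t h1 h2 => h' _ (hbox' x hx t h1 h2)
    -- If base continuity failed on the whole box, a single slice `f (·, t)` would be discontinuous
    -- throughout an open set.
    · obtain ⟨x, hx, hc⟩ := hX.continuousAt (f := fun y => f (y, t)) (by fun_prop) hT hTne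
      exact absurd hc (h' _ (hbox' x hx t ht.1 ht.2))
  obtain ⟨x, hx⟩ := hTne
  have hmem := fun y hy s h1 h2 => hV'V (hbox' y hy s h1 h2)
  have hxt := hmem x hx t ht.1 ht.2
  refine ⟨(x, t), hbox x (hVW hxt.1) t ((h x hxt.1).1.1.trans_lt hxt.2.1)
    (hxt.2.2.trans_le (h x hxt.1).1.2), ?_⟩
  refine continuousAt_of_betweenOn ht.1 ht.2 (hT.mem_nhds hx) (fun y hy s t u h1 h2 h3 h4 => ?_)
    ((h x hxt.1).2.1 t hxt.2.1 hxt.2.2) (fun s h1 h2 => hcont x hx s h1 h2)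
  have hs := hmem y hy s h1 ((h2.trans h3).trans_lt h4)
  have hu := hmem y hy u (h1.trans_le (h2.trans h3)) h4
  exact (h y hs.1).2.2 s t u hs.2.1 h2 h3 hu.2.2

theorem Tame.prod (hX : Tame M X) : Tame M (X × M) :=
  ⟨hX.const_on_prod, hX.continuousAt_prod⟩

end Tame

/-! ### Transfer to the powers `M^n`. -/

section Powers
variable {M : Type*} [LinearOrder M] [DefStr M] [TopologicalSpace M]

/-- Appending a coordinate. -/
def snocHomeo (M : Type*) [TopologicalSpace M] (n : ℕ) :
    ((Fin n → M) × M) ≃ₜ (Fin (n + 1) → M) where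
  toFun p := Fin.snoc (α := fun _ => M) p.1 p.2
  invFun x := (proj x, x (Fin.last n))
  left_inv p := by ext <;> simp [proj]
  right_inv x := by
    ext i
    refine Fin.lastCases ?_ (fun i => ?_) i <;> simp [proj]
  continuous_toFun := by
    refine continuous_pi fun i => ?_
    refine Fin.lastCases ?_ (fun i => ?_) i <;> simp <;> fun_prop
  continuous_invFun := by
    unfold proj
    fun_prop

theorem snocHomeo_castSucc {n : ℕ} (p : (Fin n → M) × M) (i : Fin n) :
    snocHomeo M n p i.castSucc = p.1 i := Fin.snoc_castSucc (α := fun _ => M) ..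

theorem snocHomeo_last {n : ℕ} (p : (Fin n → M) × M) :
    snocHomeo M n p (Fin.last n) = p.2 := Fin.snoc_last (α := fun _ => M) ..

theorem proj_snocHomeo {n : ℕ} (p : (Fin n → M) × M) : proj (snocHomeo M n p) = p.1 :=
  funext fun i => snocHomeo_castSucc p i

@[fun_prop]
theorem dfn_snocHomeo {n : ℕ} : Dfn M (fun p : (Fin n → M) × M => snocHomeo M n p) := by
  refine Dfn.pi fun i => ?_
  refine Fin.lastCases ?_ (fun i => ?_) i
  · simp only [snocHomeo_last]; fun_prop
  · simp only [snocHomeo_castSucc]; fun_prop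

@[fun_prop]
theorem dfn_proj {n : ℕ} : Dfn M (fun x : Fin (n + 1) → M => proj x) := by
  unfold proj; fun_prop

variable [OMinSk M] [OrderTopology M] [NoMinOrder M] [NoMaxOrder M] [DenselyOrdered M]

theorem tame_pow : ∀ n : ℕ, Tame M (Fin n → M)
  | 0 => by
    refine ⟨fun {P} hP U hU hne => ⟨U, Subset.rfl, hU, hne, ?_⟩, fun {f} hf U hU ⟨x, hx⟩ => ⟨x, hx, ?_⟩⟩
    · obtain ⟨x, hx⟩ := hne
      by_cases h : P x
      · exact Or.inl fun y _ => Subsingleton.elim x y ▸ h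
      · exact Or.inr fun y _ => Subsingleton.elim x y ▸ h
    · exact (continuous_of_const fun x y => congrArg f (Subsingleton.elim x y)).continuousAt
  | n + 1 => (tame_pow n).prod.of_homeomorph (snocHomeo M n) dfn_snocHomeo

end Powers

/-! ### Counting and enumerating finite fibres. -/

section Counting
variable {M : Type*} [LinearOrder M] [DefStr M] {X : Type*} [DSp M X]

/-- Having `k` elements means being listed by an injective `k`-tuple. Finiteness is needed for `k =
0`, as `ncard` also vanishes on infinite sets. -/
theorem Dfn.ncard_eq {R : X → M → Prop} (hR : Dfn M (fun p : X × M => R p.1 p.2))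
    (hfin : ∀ x, {y | R x y}.Finite) (k : ℕ) : Dfn M (fun x => {y | R x y}.ncard = k) := by
  have h : Dfn M (fun x => ∃ f : Fin k → M, (∀ i j, f i = f j → i = j) ∧
      ∀ y, R x y ↔ ¬ ∀ i, ¬ f i = y) := by
    refine Dfn.exists (Dfn.and (Dfn.forall_fin fun i => Dfn.forall_fin fun j =>
      Dfn.imp (Dfn.eq (by fun_prop) (by fun_prop)) (by fun_prop)) (Dfn.forall (Dfn.iff (by fun_prop)
        (Dfn.not (Dfn.forall_fin fun i => Dfn.not (Dfn.eq (by fun_prop) (by fun_prop)))))))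
  convert h using 2 with x
  simp only [not_forall, not_not]
  constructor
  · intro hk
    have := (hfin x).to_subtype
    have hk' : Nat.card {y | R x y} = k := hk
    obtain e := (Finite.equivFinOfCardEq hk').symm
    refine ⟨fun i => (e i : M), fun i j hij => e.injective (Subtype.ext hij), fun y =>
      ⟨fun hy => ⟨e.symm ⟨y, hy⟩, by simp⟩, ?_⟩⟩
    rintro ⟨i, rfl⟩
    exact (e i).2
  · rintro ⟨f, hf, hr⟩
    have : {y | R x y} = f '' univ := by
      ext y; simpa using hr y
    rw [this, ncard_image_of_injective _ (fun i j h => hf i j h), ncard_univ, Nat.card_eq_fintype_card,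
      Fintype.card_fin]

/-- A definable family of finite sets of bounded cardinality is enumerated by finitely many
definable functions. -/
theorem exists_enumeration [OMinSk M] [RSp M X] : ∀ (N : ℕ) {R : X → M → Prop},
    Dfn M (fun p : X × M => R p.1 p.2) → (∀ x, {y | R x y}.Finite) →
    (∀ x, {y | R x y}.ncard ≤ N) →
    ∃ f : Fin N → X → M, (∀ i, Dfn M (f i)) ∧ ∀ x y, R x y → ∃ i, y = f i x
  | 0, R, _, hfin, hN => by
    refine ⟨fun i => i.elim0, fun i => i.elim0, fun x y hxy => ?_⟩
    have : {y | R x y} = ∅ := (ncard_eq_zero (hfin x)).1 (Nat.le_zero.1 (hN x))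
    exact absurd (show y ∈ {y | R x y} from hxy) (by simp [this])
  | N + 1, R, hR, hfin, hN => by
    -- One chosen element is removed from each nonempty fibre; over empty fibres the value of `h` is
    -- arbitrary and harmless.
    obtain ⟨h, hh, hhR⟩ := skolem hR
    have hsub : ∀ x, {y | R x y ∧ ¬ y = h x} = {y | R x y} \ {h x} := fun x => rfl
    obtain ⟨f, hf, hfR⟩ := exists_enumeration N (R := fun x y => R x y ∧ ¬ y = h x)
      (Dfn.and (by fun_prop) (Dfn.not (Dfn.eq (by fun_prop) (by fun_prop))))
      (fun x => (hfin x).subset fun y hy => hy.1) (fun x => by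
        rcases {y | R x y}.eq_empty_or_nonempty with he | hne
        · rw [hsub, he]; simp
        · rw [hsub, ncard_sdiff_singleton_of_mem (show h x ∈ {y | R x y} from hhR x hne)]
          have := hN x
          omega)
    refine ⟨Fin.cons h f, fun i => ?_, fun x y hxy => ?_⟩
    · refine Fin.cases ?_ (fun i => ?_) i
      · simpa using hh
      · simpa using hf i
    · by_cases hy : y = h x
      · exact ⟨0, by simpa using hy⟩
      · obtain ⟨i, hi⟩ := hfR x y ⟨hxy, hy⟩
        exact ⟨i.succ, by simpa using hi⟩

end Counting

/-! ### Uniform finiteness. -/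

section LocallyConstant
variable {M : Type*} [LinearOrder M]

theorem exists_lt_of_finite [NoMinOrder M] [DenselyOrdered M] {S : Set M} (hS : S.Finite) (c : M) :
    ∃ p, p < c ∧ ∀ y ∈ S, y < c → y < p := by
  rcases (S ∩ Iio c).eq_empty_or_nonempty with h | h
  · obtain ⟨p, hp⟩ := exists_lt c
    exact ⟨p, hp, fun y hy hyc => absurd (show y ∈ S ∩ Iio c from ⟨hy, hyc⟩) (by simp [h])⟩
  · obtain ⟨z, hz, hmax⟩ := exists_max_image _ id (hS.inter_of_left _) h
    obtain ⟨p, hzp, hpc⟩ := exists_between (show z < c from hz.2)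
    exact ⟨p, hpc, fun y hy hyc => (hmax y ⟨hy, hyc⟩).trans_lt hzp⟩

theorem exists_gt_of_finite [NoMaxOrder M] [DenselyOrdered M] {S : Set M} (hS : S.Finite) (c : M) :
    ∃ p, c < p ∧ ∀ y ∈ S, c < y → p < y :=
  exists_lt_of_finite (M := Mᵒᵈ) hS c

variable [TopologicalSpace M]

/-- A definable form of the condition that the fibre over `s` of a family of finite sets moves
continuously with `s` near `t`. -/
structure MovesContinuouslyAt (A : M → M → Prop) (t : M) : Prop where
  bdd : ∃ l u, ∀ᶠ s in 𝓝 t, ∀ y, A s y → l < y ∧ y < u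
  empty : ∀ c d, (∀ y, c ≤ y → y ≤ d → ¬ A t y) → ∀ᶠ s in 𝓝 t, ∀ y, c ≤ y → y ≤ d → ¬ A s y
  single : ∀ c d, ¬ A t c → ¬ A t d →
    (∃ z, (c ≤ z ∧ z ≤ d ∧ A t z) ∧ ∀ y, c ≤ y → y ≤ d → A t y → y = z) →
    ∀ᶠ s in 𝓝 t, ∃ z, (c ≤ z ∧ z ≤ d ∧ A s z) ∧ ∀ y, c ≤ y → y ≤ d → A s y → y = z

/-- Induction on `k`: cut at a point `w` just below the largest element. Exactly one element lies
above `w`, and for nearby `s` the point `w` stays off the fibre, so the counts on the two sides add.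
-/
theorem MovesContinuouslyAt.eventually_ncard_Icc [NoMinOrder M] [DenselyOrdered M]
    {A : M → M → Prop} {t : M} (h : MovesContinuouslyAt A t) (hfin : ∀ s, {y | A s y}.Finite)
    (k : ℕ) : ∀ c d, ¬ A t c → ¬ A t d → {y | (c ≤ y ∧ y ≤ d) ∧ A t y}.ncard = k →
      ∀ᶠ s in 𝓝 t, {y | (c ≤ y ∧ y ≤ d) ∧ A s y}.ncard = k := by
  have hfin' : ∀ s c d, {y | (c ≤ y ∧ y ≤ d) ∧ A s y}.Finite := fun s c d =>
    (hfin s).subset fun y hy => hy.2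
  have hone : ∀ s c d, {y | (c ≤ y ∧ y ≤ d) ∧ A s y}.ncard = 1 ↔
      ∃ z, (c ≤ z ∧ z ≤ d ∧ A s z) ∧ ∀ y, c ≤ y → y ≤ d → A s y → y = z := by
    intro s c d
    rw [ncard_eq_one]
    refine exists_congr fun z => ⟨fun h => ?_, fun h => ?_⟩
    · have hz : z ∈ {y | (c ≤ y ∧ y ≤ d) ∧ A s y} := by rw [h]; rfl
      refine ⟨⟨hz.1.1, hz.1.2, hz.2⟩, fun y h1 h2 h3 => ?_⟩
      have hy : y ∈ {y | (c ≤ y ∧ y ≤ d) ∧ A s y} := ⟨⟨h1, h2⟩, h3⟩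
      rwa [h] at hy
    · ext y
      constructor
      · exact fun hy => h.2 y hy.1.1 hy.1.2 hy.2
      · rintro rfl
        exact ⟨⟨h.1.1, h.1.2.1⟩, h.1.2.2⟩
  have hadd : ∀ s c w d, c ≤ w → w ≤ d → ¬ A s w → {y | (c ≤ y ∧ y ≤ d) ∧ A s y}.ncard =
      {y | (c ≤ y ∧ y ≤ w) ∧ A s y}.ncard + {y | (w ≤ y ∧ y ≤ d) ∧ A s y}.ncard := by
    intro s c w d hcw hwd hw
    rw [← ncard_union_eq ?_ (hfin' s c w) (hfin' s w d)]
    · congr 1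
      ext y
      constructor
      · rintro ⟨⟨h1, h2⟩, h3⟩
        exact (le_total y w).imp (fun h => ⟨⟨h1, h⟩, h3⟩) (fun h => ⟨⟨h, h2⟩, h3⟩)
      · rintro (⟨⟨h1, h2⟩, h3⟩ | ⟨⟨h1, h2⟩, h3⟩)
        exacts [⟨⟨h1, h2.trans hwd⟩, h3⟩, ⟨⟨hcw.trans h1, h2⟩, h3⟩]
    · rw [Set.disjoint_left]
      rintro y ⟨⟨-, h1⟩, h3⟩ ⟨⟨h2, -⟩, -⟩
      exact hw (le_antisymm h1 h2 ▸ h3)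
  induction k with
  | zero =>
    intro c d hc hd h0
    rw [ncard_eq_zero (hfin' t c d)] at h0
    filter_upwards [h.empty c d fun y h1 h2 h3 => by
      have : y ∈ {y | (c ≤ y ∧ y ≤ d) ∧ A t y} := ⟨⟨h1, h2⟩, h3⟩
      simp [h0] at this] with s hs
    rw [ncard_eq_zero (hfin' s c d)]
    exact eq_empty_of_forall_notMem fun y hy => hs y hy.1.1 hy.1.2 hy.2
  | succ k ih =>
    intro c d hc hd hk
    obtain ⟨z, hz, hmax⟩ := exists_max_image _ id (hfin' t c d)
      (nonempty_of_ncard_ne_zero (by omega))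
    have hcz : c < z := lt_of_le_of_ne hz.1.1 (by rintro rfl; exact hc hz.2)
    obtain ⟨w, hwz, hw⟩ := exists_lt_of_finite ((hfin t).insert c) z
    have hcw : c < w := hw c (mem_insert _ _) hcz
    have hAw : ¬ A t w := fun h => lt_irrefl _ (hw w (mem_insert_of_mem _ h) hwz)
    have hwd : w ≤ d := hwz.le.trans hz.1.2
    have h1 : {y | (w ≤ y ∧ y ≤ d) ∧ A t y}.ncard = 1 :=
      (hone t w d).2 ⟨z, ⟨hwz.le, hz.1.2, hz.2⟩, fun y hwy hyd hy =>
        le_antisymm (hmax y ⟨⟨hcw.le.trans hwy, hyd⟩, hy⟩) (not_lt.1 fun hyz =>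
          absurd (hw y (mem_insert_of_mem _ hy) hyz) (not_lt.2 hwy))⟩
    have h2 := hadd t c w d hcw.le hwd hAw
    filter_upwards [ih c w hc hAw (by omega), h.single w d hAw hd ((hone t w d).1 h1),
      h.empty w w fun y h1 h2 => le_antisymm h2 h1 ▸ hAw] with s hs1 hs2 hs3
    rw [hadd s c w d hcw.le hwd (hs3 w le_rfl le_rfl), hs1, (hone s w d).2 hs2]

theorem MovesContinuouslyAt.eventually_ncard [NoMinOrder M] [DenselyOrdered M]
    {A : M → M → Prop} {t : M} (h : MovesContinuouslyAt A t) (hfin : ∀ s, {y | A s y}.Finite) :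
    ∀ᶠ s in 𝓝 t, {y | A s y}.ncard = {y | A t y}.ncard := by
  obtain ⟨l, u, hlu⟩ := h.bdd
  have hset : ∀ s, (∀ y, A s y → l < y ∧ y < u) → {y | (l ≤ y ∧ y ≤ u) ∧ A s y} = {y | A s y} :=
    fun s hs => Set.ext fun y => ⟨fun hy => hy.2, fun hy => ⟨⟨(hs y hy).1.le, (hs y hy).2.le⟩, hy⟩⟩
  have ht := hlu.self_of_nhds
  filter_upwards [hlu, h.eventually_ncard_Icc hfin _ l u (fun hl => lt_irrefl _ (ht l hl).1)
    (fun hu => lt_irrefl _ (ht u hu).2) rfl] with s hs1 hs2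
  rwa [hset s hs1, hset t ht] at hs2

end LocallyConstant

section Uniform
variable {M : Type*} [LinearOrder M] [DefStr M] [OMinSk M] [TopologicalSpace M] [OrderTopology M]
  [NoMinOrder M] [NoMaxOrder M] [DenselyOrdered M] {X Y : Type*} [DSp M X] [DSp M Y]

theorem Dfn.movesContinuouslyAt {A : X → M → M → Prop}
    (hA : Dfn M (fun p : X × M × M => A p.1 p.2.1 p.2.2)) :
    Dfn M (fun p : X × M => MovesContinuouslyAt (A p.1) p.2) := by
  have h1 : Dfn M (fun p : X × M => ∃ l u, ∀ᶠ s in 𝓝 p.2, ∀ y, A p.1 s y → l < y ∧ y < u) :=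
    Dfn.exists (Dfn.exists (Dfn.eventually_nhds
      (R := fun (q : ((X × M) × M) × M) s => ∀ y, A q.1.1.1 s y → q.1.2 < y ∧ y < q.2)
      (Dfn.forall (Dfn.imp (by fun_prop) (by fun_prop))) (by fun_prop)))
  have h2 : Dfn M (fun p : X × M => ∀ c d, (∀ y, c ≤ y → y ≤ d → ¬ A p.1 p.2 y) →
      ∀ᶠ s in 𝓝 p.2, ∀ y, c ≤ y → y ≤ d → ¬ A p.1 s y) :=
    Dfn.forall (Dfn.forall (Dfn.imp
      (Dfn.forall (Dfn.imp (by fun_prop) (Dfn.imp (by fun_prop) (by fun_prop))))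
      (Dfn.eventually_nhds
        (R := fun (q : ((X × M) × M) × M) s => ∀ y, q.1.2 ≤ y → y ≤ q.2 → ¬ A q.1.1.1 s y)
        (Dfn.forall (Dfn.imp (by fun_prop) (Dfn.imp (by fun_prop) (by fun_prop)))) (by fun_prop))))
  have hz : Dfn M (fun q : X × M × M × M => ∃ z, (q.2.2.1 ≤ z ∧ z ≤ q.2.2.2 ∧ A q.1 q.2.1 z) ∧
      ∀ y, q.2.2.1 ≤ y → y ≤ q.2.2.2 → A q.1 q.2.1 y → y = z) :=
    Dfn.exists (Dfn.and (by fun_prop) (Dfn.forall (Dfn.imp (by fun_prop) (Dfn.imp (by fun_prop)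
      (Dfn.imp (by fun_prop) (Dfn.eq (by fun_prop) (by fun_prop)))))))
  have h3 : Dfn M (fun p : X × M => ∀ c d, ¬ A p.1 p.2 c → ¬ A p.1 p.2 d →
      (∃ z, (c ≤ z ∧ z ≤ d ∧ A p.1 p.2 z) ∧ ∀ y, c ≤ y → y ≤ d → A p.1 p.2 y → y = z) →
      ∀ᶠ s in 𝓝 p.2, ∃ z, (c ≤ z ∧ z ≤ d ∧ A p.1 s z) ∧ ∀ y, c ≤ y → y ≤ d → A p.1 s y → y = z) :=
    Dfn.forall (Dfn.forall (Dfn.imp (by fun_prop) (Dfn.imp (by fun_prop) (Dfn.imp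
      (Dfn.comp hz (g := fun q : ((X × M) × M) × M => (q.1.1.1, q.1.1.2, q.1.2, q.2)) (by fun_prop))
      (Dfn.eventually_nhds
        (R := fun (q : ((X × M) × M) × M) s => ∃ z, (q.1.2 ≤ z ∧ z ≤ q.2 ∧ A q.1.1.1 s z) ∧
          ∀ y, q.1.2 ≤ y → y ≤ q.2 → A q.1.1.1 s y → y = z)
        (Dfn.comp hz (g := fun q : (((X × M) × M) × M) × M => (q.1.1.1.1, q.2, q.1.1.2, q.1.2))
          (by fun_prop)) (by fun_prop))))))
  convert Dfn.and h1 (Dfn.and h2 h3) using 2 with p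
  exact ⟨fun h => ⟨h.1, h.2, h.3⟩, fun h => ⟨h.1, h.2.1, h.2.2⟩⟩

/-- Each clause fails only finitely often. A clause failing on a whole interval would have definably
chosen witnesses of failure, and continuity of the auxiliary data at one good `t` then refutes the
failure at `t`. -/
theorem eventually_cofinite_movesContinuouslyAt {A : M → M → Prop}
    (hA : Dfn M (fun p : M × M => A p.1 p.2)) (hfin : ∀ t, {y | A t y}.Finite) :
    ∀ᶠ t in cofinite, MovesContinuouslyAt A t := by
  have hbdd : ∀ᶠ t in cofinite, ∃ l u, ∀ᶠ s in 𝓝 t, ∀ y, A s y → l < y ∧ y < u := by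
    obtain ⟨g, hg, hgA⟩ := skolem (M := M) (X := M) (Y := M × M)
      (R := fun t p => ∀ y, A t y → p.1 < y ∧ y < p.2)
      (Dfn.forall (Dfn.imp (by fun_prop) (by fun_prop)))
    have hspec : ∀ t y, A t y → (g t).1 < y ∧ y < (g t).2 := fun t => hgA t (by
      have : Nonempty M := ⟨t⟩
      obtain ⟨l, hl⟩ := (hfin t).bddBelow
      obtain ⟨u, hu⟩ := (hfin t).bddAbove
      obtain ⟨l', hl'⟩ := exists_lt l
      obtain ⟨u', hu'⟩ := exists_gt u
      exact ⟨(l', u'), fun y hy => ⟨hl'.trans_le (hl hy), (hu hy).trans_lt hu'⟩⟩)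
    filter_upwards [eventually_cofinite_continuousAt (f := fun t => (g t).1) (by fun_prop),
      eventually_cofinite_continuousAt (f := fun t => (g t).2) (by fun_prop)] with t h1 h2
    obtain ⟨l, hl⟩ := exists_lt (g t).1
    obtain ⟨u, hu⟩ := exists_gt (g t).2
    refine ⟨l, u, ?_⟩
    filter_upwards [h1.eventually (eventually_gt_nhds hl), h2.eventually (eventually_lt_nhds hu)]
      with s hs1 hs2 y hy
    exact ⟨hs1.trans (hspec s y hy).1, (hspec s y hy).2.trans hs2⟩
  have hempty : ∀ᶠ t in cofinite, ∀ c d, (∀ y, c ≤ y → y ≤ d → ¬ A t y) →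
      ∀ᶠ s in 𝓝 t, ∀ y, c ≤ y → y ≤ d → ¬ A s y := by
    have hev : Dfn M (fun q : M × M × M => ∀ᶠ s in 𝓝 q.1, ∀ y, q.2.1 ≤ y → y ≤ q.2.2 → ¬ A s y) :=
      Dfn.eventually_nhds (R := fun (q : M × M × M) s => ∀ y, q.2.1 ≤ y → y ≤ q.2.2 → ¬ A s y)
        (Dfn.forall (Dfn.imp (by fun_prop) (Dfn.imp (by fun_prop) (by fun_prop)))) (by fun_prop)
    refine eventually_cofinite_of_dense (Dfn.forall (Dfn.forall (Dfn.imp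
      (Dfn.forall (Dfn.imp (by fun_prop) (Dfn.imp (by fun_prop) (by fun_prop))))
      (Dfn.comp hev (g := fun q : (M × M) × M => (q.1.1, q.1.2, q.2)) (by fun_prop)))))
      fun a b hab => ?_
    by_contra hcon
    -- Besides the failing interval `[c, d]`, a strictly larger `[p, q]` still missing the fibre is
    -- chosen. Where `p` and `q` are continuous, `[p(s), q(s)]` contains `[c(t), d(t)]` for `s` near
    -- `t`; continuity of `c` and `d` is not needed.
    obtain ⟨g, hg, hgA⟩ := skolem (M := M) (X := M) (Y := (M × M) × M × M)
      (R := fun t p => (p.2.1 < p.1.1 ∧ p.1.2 < p.2.2 ∧ ∀ y, p.2.1 ≤ y → y ≤ p.2.2 → ¬ A t y) ∧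
        ¬ ∀ᶠ s in 𝓝 t, ∀ y, p.1.1 ≤ y → y ≤ p.1.2 → ¬ A s y)
      (Dfn.and (Dfn.and (by fun_prop) (Dfn.and (by fun_prop)
          (Dfn.forall (Dfn.imp (by fun_prop) (Dfn.imp (by fun_prop) (by fun_prop))))))
        (Dfn.not (Dfn.comp hev (g := fun q : M × (M × M) × M × M => (q.1, q.2.1.1, q.2.1.2))
          (by fun_prop))))
    have hspec := fun t (hat : a < t) (htb : t < b) => hgA t (by
      have hcon' := fun h => hcon ⟨t, hat, htb, h⟩
      simp only [imp_false, not_forall, exists_prop] at hcon'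
      obtain ⟨c, d, hcd, hn⟩ := hcon'
      obtain ⟨p, hpc, hp⟩ := exists_lt_of_finite (hfin t) c
      obtain ⟨q, hdq, hq⟩ := exists_gt_of_finite (hfin t) d
      refine ⟨((c, d), p, q), ⟨hpc, hdq, fun y h1 h2 hy => ?_⟩, hn⟩
      rcases lt_or_ge y c with h3 | h3
      · exact absurd (hp y hy h3) (not_lt.2 h1)
      rcases lt_or_ge d y with h4 | h4
      · exact absurd (hq y hy h4) (not_lt.2 h2)
      exact hcd y h3 h4 hy)
    obtain ⟨t, ⟨h1, h2⟩, hat, htb⟩ := (((eventually_cofinite_continuousAt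
      (f := fun t => (g t).2.1) (by fun_prop)).and
      (eventually_cofinite_continuousAt (f := fun t => (g t).2.2) (by fun_prop))).and_frequently
        (frequently_cofinite_iff_infinite.2 (Ioo_infinite hab))).exists
    obtain ⟨⟨h3, h4, h5⟩, h6⟩ := hspec t hat htb
    apply h6
    filter_upwards [h1.eventually (eventually_lt_nhds h3), h2.eventually (eventually_gt_nhds h4),
      Ioo_mem_nhds hat htb] with s hs1 hs2 hs3 y hy1 hy2
    exact (hspec s hs3.1 hs3.2).1.2.2 y (hs1.le.trans hy1) (hy2.trans hs2.le)
  have hsingle : ∀ᶠ t in cofinite, ∀ c d, ¬ A t c → ¬ A t d →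
      (∃ z, (c ≤ z ∧ z ≤ d ∧ A t z) ∧ ∀ y, c ≤ y → y ≤ d → A t y → y = z) →
      ∀ᶠ s in 𝓝 t, ∃ z, (c ≤ z ∧ z ≤ d ∧ A s z) ∧ ∀ y, c ≤ y → y ≤ d → A s y → y = z := by
    have hz : Dfn M (fun q : M × M × M => ∃ z, (q.2.1 ≤ z ∧ z ≤ q.2.2 ∧ A q.1 z) ∧
        ∀ y, q.2.1 ≤ y → y ≤ q.2.2 → A q.1 y → y = z) :=
      Dfn.exists (Dfn.and (by fun_prop) (Dfn.forall (Dfn.imp (by fun_prop) (Dfn.imp (by fun_prop)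
        (Dfn.imp (by fun_prop) (Dfn.eq (by fun_prop) (by fun_prop)))))))
    have hev : Dfn M (fun q : M × M × M => ∀ᶠ s in 𝓝 q.1, ∃ z, (q.2.1 ≤ z ∧ z ≤ q.2.2 ∧ A s z) ∧
        ∀ y, q.2.1 ≤ y → y ≤ q.2.2 → A s y → y = z) :=
      Dfn.eventually_nhds (R := fun (q : M × M × M) s => ∃ z, (q.2.1 ≤ z ∧ z ≤ q.2.2 ∧ A s z) ∧
        ∀ y, q.2.1 ≤ y → y ≤ q.2.2 → A s y → y = z)
        (Dfn.comp hz (g := fun q : (M × M × M) × M => (q.2, q.1.2)) (by fun_prop)) (by fun_prop)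
    refine eventually_cofinite_of_dense (Dfn.forall (Dfn.forall (Dfn.imp (by fun_prop)
      (Dfn.imp (by fun_prop) (Dfn.imp
      (Dfn.comp hz (g := fun q : (M × M) × M => (q.1.1, q.1.2, q.2)) (by fun_prop))
      (Dfn.comp hev (g := fun q : (M × M) × M => (q.1.1, q.1.2, q.2)) (by fun_prop)))))))
      fun a b hab => ?_
    by_contra hcon
    -- The same margin `[p, q]` is used, together with the unique point `z` of the fibre; continuity
    -- of `z` keeps it inside `[c(t), d(t)]`.
    obtain ⟨g, hg, hgA⟩ := skolem (M := M) (X := M) (Y := ((M × M) × M × M) × M)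
      (R := fun t p => ((p.1.2.1 < p.1.1.1 ∧ p.1.1.1 < p.2 ∧ p.2 < p.1.1.2 ∧ p.1.1.2 < p.1.2.2) ∧
        A t p.2 ∧ ∀ y, p.1.2.1 ≤ y → y ≤ p.1.2.2 → A t y → y = p.2) ∧
        ¬ ∀ᶠ s in 𝓝 t, ∃ z, (p.1.1.1 ≤ z ∧ z ≤ p.1.1.2 ∧ A s z) ∧
          ∀ y, p.1.1.1 ≤ y → y ≤ p.1.1.2 → A s y → y = z)
      (Dfn.and (Dfn.and (by fun_prop) (Dfn.and (by fun_prop)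
          (Dfn.forall (Dfn.imp (by fun_prop) (Dfn.imp (by fun_prop) (Dfn.imp (by fun_prop)
            (Dfn.eq (by fun_prop) (by fun_prop))))))))
        (Dfn.not (Dfn.comp hev (g := fun q : M × ((M × M) × M × M) × M =>
          (q.1, q.2.1.1.1, q.2.1.1.2)) (by fun_prop))))
    have hspec := fun t (hat : a < t) (htb : t < b) => hgA t (by
      have hcon' := fun h => hcon ⟨t, hat, htb, h⟩
      simp only [imp_false, not_forall, exists_prop] at hcon'
      obtain ⟨c, d, hc, hd, ⟨z, ⟨hcz, hzd, hz⟩, huniq⟩, hn⟩ := hcon'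
      obtain ⟨p, hpc, hp⟩ := exists_lt_of_finite (hfin t) c
      obtain ⟨q, hdq, hq⟩ := exists_gt_of_finite (hfin t) d
      refine ⟨(((c, d), p, q), z), ⟨⟨hpc, lt_of_le_of_ne hcz (fun h : c = z => hc (h ▸ hz)),
        lt_of_le_of_ne hzd (fun h : z = d => hd (h ▸ hz)), hdq⟩, hz, fun y h1 h2 hy => ?_⟩, hn⟩
      rcases lt_or_ge y c with h3 | h3
      · exact absurd (hp y hy h3) (not_lt.2 h1)
      rcases lt_or_ge d y with h4 | h4
      · exact absurd (hq y hy h4) (not_lt.2 h2)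
      exact huniq y h3 h4 hy)
    obtain ⟨t, ⟨h1, h2, h2'⟩, hat, htb⟩ := (((eventually_cofinite_continuousAt
      (f := fun t => (g t).1.2.1) (by fun_prop)).and ((eventually_cofinite_continuousAt
      (f := fun t => (g t).1.2.2) (by fun_prop)).and
      (eventually_cofinite_continuousAt (f := fun t => (g t).2) (by fun_prop)))).and_frequently
        (frequently_cofinite_iff_infinite.2 (Ioo_infinite hab))).exists
    obtain ⟨⟨⟨h3, h4, h5, h6⟩, h7, h8⟩, h9⟩ := hspec t hat htb
    apply h9
    filter_upwards [h1.eventually (eventually_lt_nhds h3), h2.eventually (eventually_gt_nhds h6),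
      h2'.eventually (eventually_gt_nhds h4), h2'.eventually (eventually_lt_nhds h5),
      Ioo_mem_nhds hat htb] with s hs1 hs2 hs3 hs4 hs5
    have := (hspec s hs5.1 hs5.2).1
    exact ⟨(g s).2, ⟨hs3.le, hs4.le, this.2.1⟩, fun y hy1 hy2 hy =>
      this.2.2 y (hs1.le.trans hy1) (hy2.trans hs2.le) hy⟩
  filter_upwards [hbdd, hempty, hsingle] with t h1 h2 h3
  exact ⟨h1, h2, h3⟩

theorem ncard_eq_of_movesContinuously {A : M → M → Prop} (hA : Dfn M (fun p : M × M => A p.1 p.2))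
    (hfin : ∀ t, {y | A t y}.Finite) {a b : M} (hab : a ≤ b)
    (h : ∀ t, a ≤ t → t ≤ b → MovesContinuouslyAt A t) :
    {y | A b y}.ncard = {y | A a y}.ncard := by
  rcases eq_or_lt_of_le hab with rfl | hab
  · rfl
  refine interval_induction (M := M) (P := fun t => {y | A t y}.ncard = {y | A a y}.ncard)
    (Dfn.ncard_eq hA hfin _) ?_ ?_ ?_ b hab le_rfl
  · exact ((h a le_rfl hab.le).eventually_ncard hfin).filter_mono nhdsWithin_le_nhds
  · intro s has hsb hy
    obtain ⟨y, hys, hay, hyb⟩ := ((((h s has.le hsb).eventually_ncard hfin).filter_mono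
      nhdsWithin_le_nhds).and (Ioo_mem_nhdsLT has)).exists
    exact hys.symm.trans (hy y hay hyb)
  · intro s has hsb hs
    exact (((h s has.le hsb.le).eventually_ncard hfin).filter_mono
      nhdsWithin_le_nhds).mono fun y hy => hy.trans hs

end Uniform

/-- Definable families of finite subsets of `M` indexed by `X` have bounded cardinality. -/
def UnifFinite (M : Type*) [LinearOrder M] [DefStr M] (X : Type*) [DSp M X] : Prop :=
  ∀ R : X → M → Prop, Dfn M (fun p : X × M => R p.1 p.2) → (∀ x, {y | R x y}.Finite) →
    ∃ N, ∀ x, {y | R x y}.ncard ≤ N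

section Uniform
variable {M : Type*} [LinearOrder M] [DefStr M] [OMinSk M] [TopologicalSpace M] [OrderTopology M]
  [NoMinOrder M] [NoMaxOrder M] [DenselyOrdered M] {X Y : Type*} [DSp M X] [DSp M Y]

/-- For fixed `x` the exceptional `t` are finite in number, so by the hypothesis on `X` they are
boundedly many and are covered by functions `b i`. The count is constant between consecutive
exceptional values, so it suffices to sample at each `b i`, at a point `τ i` just to its right, and
at a point `g` to the left of all of them. Each sample is a family over `X`, bounded by hypothesis.
-/
theorem UnifFinite.prod [RSp M X] (hX : UnifFinite M X) : UnifFinite M (X × M) := by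
  intro R hR hfin
  have hgood : Dfn M (fun p : X × M => MovesContinuouslyAt (fun t y => R (p.1, t) y) p.2) :=
    Dfn.movesContinuouslyAt (A := fun x t y => R (x, t) y) (by fun_prop)
  have hbadfin : ∀ x, {t | ¬ MovesContinuouslyAt (fun t y => R (x, t) y) t}.Finite := fun x =>
    eventually_cofinite.1 (eventually_cofinite_movesContinuouslyAt (A := fun t y => R (x, t) y)
      (by fun_prop) fun t => hfin (x, t))
  obtain ⟨K, hK⟩ := hX (R := fun x t => ¬ MovesContinuouslyAt (fun t y => R (x, t) y) t)
    (by fun_prop) hbadfin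
  obtain ⟨b, hb, hbad⟩ := exists_enumeration K (by fun_prop) hbadfin hK
  have hbound : ∀ g : X → M, Dfn M g → ∃ N, ∀ x, {y | R (x, g x) y}.ncard ≤ N := fun g hg =>
    hX (R := fun x y => R (x, g x) y) (by fun_prop) fun x => hfin (x, g x)
  have hconst : ∀ x t s, (∀ r, (s ≤ r ∨ t ≤ r) → (r ≤ s ∨ r ≤ t) →
      MovesContinuouslyAt (fun t y => R (x, t) y) r) → {y | R (x, t) y}.ncard = {y | R (x, s) y}.ncard := by
    intro x t s h
    rcases le_total s t with hst | hst
    · exact ncard_eq_of_movesContinuously (A := fun t y => R (x, t) y) (by fun_prop)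
        (fun t => hfin (x, t)) hst fun r h1 h2 => h r (Or.inl h1) (Or.inr h2)
    · exact (ncard_eq_of_movesContinuously (A := fun t y => R (x, t) y) (by fun_prop)
        (fun t => hfin (x, t)) hst fun r h1 h2 => h r (Or.inr h1) (Or.inl h2)).symm
  obtain ⟨g, hg, hgR⟩ := skolem (M := M) (X := X) (Y := M)
    (R := fun x s => ∀ r, r ≤ s → MovesContinuouslyAt (fun t y => R (x, t) y) r)
    (Dfn.forall (Dfn.imp (by fun_prop) (Dfn.comp hgood
      (g := fun q : (X × M) × M => (q.1.1, q.2)) (by fun_prop))))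
  have hτ : ∀ i, ∃ τ : X → M, Dfn M τ ∧ ∀ x,
      (∃ s, b i x < s ∧ ∀ r, b i x < r → r ≤ s → MovesContinuouslyAt (fun t y => R (x, t) y) r) →
      (b i x < τ x ∧ ∀ r, b i x < r → r ≤ τ x → MovesContinuouslyAt (fun t y => R (x, t) y) r) :=
    fun i => skolem (M := M) (X := X) (Y := M) (R := fun x s => b i x < s ∧
      ∀ r, b i x < r → r ≤ s → MovesContinuouslyAt (fun t y => R (x, t) y) r)
      (by
        have := hb i
        exact Dfn.and (by fun_prop) (Dfn.forall (Dfn.imp (by fun_prop) (Dfn.imp (by fun_prop)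
          (Dfn.comp hgood (g := fun q : (X × M) × M => (q.1.1, q.2)) (by fun_prop))))))
  choose τ hτd hτR using hτ
  obtain ⟨N0, hN0⟩ := hbound g hg
  choose N1 hN1 using fun i => hbound (b i) (hb i)
  choose N2 hN2 using fun i => hbound (τ i) (hτd i)
  refine ⟨N0 + (∑ i, N1 i + ∑ i, N2 i), fun ⟨x, t⟩ => ?_⟩
  by_cases ht : MovesContinuouslyAt (fun t y => R (x, t) y) t
  swap
  · obtain ⟨i, rfl⟩ := hbad x t ht
    have := Finset.single_le_sum (f := N1) (fun i _ => Nat.zero_le _) (Finset.mem_univ i)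
    have := hN1 i x
    omega
  rcases ({r | ¬ MovesContinuouslyAt (fun t y => R (x, t) y) r} ∩ Iio t).eq_empty_or_nonempty
    with he | hne
  · have hall : ∀ r, r ≤ t → MovesContinuouslyAt (fun t y => R (x, t) y) r := by
      intro r hr
      by_contra hbr
      have hrt : r < t := lt_of_le_of_ne hr (by rintro rfl; exact hbr ht)
      have hmem : r ∈ {r | ¬ MovesContinuouslyAt (fun t y => R (x, t) y) r} ∩ Iio t := ⟨hbr, hrt⟩
      rw [he] at hmem
      exact hmem
    have := hN0 x
    rw [hconst x t (g x) fun r _ hr => hr.elim (hgR x ⟨t, hall⟩ r) (hall r)]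
    omega
  -- `r0` is the last exceptional value below `t`, so `t` and the corresponding `τ i` lie in the
  -- same gap.
  · obtain ⟨r0, ⟨hr0, hr0t⟩, hmax⟩ := exists_max_image _ id ((hbadfin x).inter_of_left _) hne
    obtain ⟨i, rfl⟩ := hbad x r0 hr0
    have hall : ∀ r, b i x < r → r ≤ t → MovesContinuouslyAt (fun t y => R (x, t) y) r := by
      intro r hbr hr
      by_contra hbad'
      have hrt : r < t := lt_of_le_of_ne hr (by rintro rfl; exact hbad' ht)
      exact absurd hbr (not_lt.2 (hmax r ⟨hbad', hrt⟩))
    have hτx := hτR i x ⟨t, hr0t, hall⟩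
    have := Finset.single_le_sum (f := N2) (fun i _ => Nat.zero_le _) (Finset.mem_univ i)
    have := hN2 i x
    rw [hconst x t (τ i x) fun r hr1 hr2 => ?_]
    · omega
    · have hbr : b i x < r := hr1.elim hτx.1.trans_le (lt_of_lt_of_le hr0t)
      exact hr2.elim (hτx.2 r hbr) (hall r hbr)

theorem UnifFinite.of_equiv (hX : UnifFinite M X) (e : X ≃ Y) (he : Dfn M e) : UnifFinite M Y := by
  intro R hR hfin
  obtain ⟨N, hN⟩ := hX (R := fun x y => R (e x) y) (by fun_prop) fun x => hfin (e x)
  exact ⟨N, fun y => by simpa using hN (e.symm y)⟩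

theorem unifFinite_pow : ∀ n : ℕ, UnifFinite M (Fin n → M)
  | 0 => fun R _ _ => ⟨_, fun x => (congrArg (fun x => {y | R x y}.ncard)
      (Subsingleton.elim x (fun i => i.elim0))).le⟩
  | n + 1 => (UnifFinite.prod (unifFinite_pow n)).of_equiv (snocHomeo M n).toEquiv dfn_snocHomeo

end Uniform

/-! ### Graph pieces. -/

/-- `S` is the image of a continuous definable map `g` on an open definable subset `D` of some
power of `M`, such that a choice of coordinates in `J` is a left inverse of `g`. -/
def IsGraphPiece {M : Type*} [LinearOrder M] [DefStr M] [TopologicalSpace M] {m : ℕ}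
    (J : Set (Fin m)) (S : Set (Fin m → M)) : Prop :=
  ∃ (d : ℕ) (ι : Fin d ↪ Fin m) (D : Set (Fin d → M)) (g : (Fin d → M) → Fin m → M),
    range ι ⊆ J ∧ IsOpen D ∧ Dfn M (fun y => y ∈ D) ∧ Dfn M g ∧ ContinuousOn g D ∧
      (∀ y ∈ D, ∀ i, g y (ι i) = y i) ∧ S = g '' D

/-- `S` is a finite union of graph pieces. -/
def Decomposable {M : Type*} [LinearOrder M] [DefStr M] [TopologicalSpace M] {m : ℕ}
    (J : Set (Fin m)) (S : Set (Fin m → M)) : Prop :=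
  ∃ F : Set (Set (Fin m → M)), F.Finite ∧ (∀ T ∈ F, IsGraphPiece J T) ∧ S = ⋃₀ F

section Decomposable
variable {M : Type*} [LinearOrder M] [DefStr M] [TopologicalSpace M] {m : ℕ} {J K : Set (Fin m)}
  {S T : Set (Fin m → M)}

theorem IsGraphPiece.decomposable (h : IsGraphPiece J S) : Decomposable J S :=
  ⟨{S}, finite_singleton S, by simpa using h, by simp⟩

theorem Decomposable.mono (h : Decomposable J S) (hJK : J ⊆ K) : Decomposable K S := by
  obtain ⟨F, hF, hp, rfl⟩ := h
  refine ⟨F, hF, fun T hT => ?_, rfl⟩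
  obtain ⟨d, ι, D, g, h1, h2⟩ := hp T hT
  exact ⟨d, ι, D, g, h1.trans hJK, h2⟩

theorem Decomposable.biUnion {α : Type*} {I : Set α} (hI : I.Finite) {s : α → Set (Fin m → M)}
    (h : ∀ i ∈ I, Decomposable J (s i)) : Decomposable J (⋃ i ∈ I, s i) := by
  choose! F hF hp hs using h
  refine ⟨⋃ i ∈ I, F i, hI.biUnion hF, fun T hT => ?_, ?_⟩
  · obtain ⟨i, hi, hT⟩ := mem_iUnion₂.1 hT
    exact hp i hi T hT
  · rw [sUnion_iUnion]
    refine iUnion_congr fun i => ?_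
    rw [sUnion_iUnion]
    exact iUnion_congr fun hi => hs i hi

theorem Decomposable.iUnion {α : Type*} [Finite α] {s : α → Set (Fin m → M)}
    (h : ∀ i, Decomposable J (s i)) : Decomposable J (⋃ i, s i) := by
  simpa using Decomposable.biUnion (finite_univ (α := α)) (s := s) fun i _ => h i

theorem Decomposable.union (hS : Decomposable J S) (hT : Decomposable J T) :
    Decomposable J (S ∪ T) := by
  obtain ⟨F, hF, hp, rfl⟩ := hS
  obtain ⟨F', hF', hp', rfl⟩ := hT
  exact ⟨F ∪ F', hF.union hF', fun T hT => hT.elim (hp T) (hp' T), (sUnion_union _ _).symm⟩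

theorem Decomposable.empty : Decomposable J (∅ : Set (Fin m → M)) :=
  ⟨∅, finite_empty, by simp, by simp⟩

end Decomposable

/-! ### Decomposition into graph pieces and the construction of sections. -/

section Main
variable {M : Type*} [LinearOrder M] [DefStr M] [OMinSk M] [TopologicalSpace M] [OrderTopology M]
  [NoMinOrder M] [NoMaxOrder M] [DenselyOrdered M]

theorem Tame.exists_continuousAt_pi {X : Type*} [DSp M X] [TopologicalSpace X] [DTop M X]
    (hX : Tame M X) {m : ℕ} {G : X → Fin m → M} (hG : Dfn M G) {U : Set X} (hU : IsOpen U)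
    (hne : U.Nonempty) : ∃ V ⊆ U, IsOpen V ∧ V.Nonempty ∧ ∀ x ∈ V, ContinuousAt G x := by
  have key : ∀ s : Finset (Fin m), ∃ V ⊆ U, IsOpen V ∧ V.Nonempty ∧
      ∀ x ∈ V, ∀ i ∈ s, ContinuousAt (fun x => G x i) x := by
    intro s
    induction s using Finset.induction_on with
    | empty => exact ⟨U, Subset.rfl, hU, hne, by simp⟩
    | insert i s _ ih =>
      obtain ⟨V, hVU, hV, hVne, h⟩ := ih
      obtain ⟨V', hV'V, hV', hne', h'⟩ := hX.exists_continuousOn (f := fun x => G x i)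
        (by fun_prop) hV hVne
      refine ⟨V', hV'V.trans hVU, hV', hne', fun x hx j hj => ?_⟩
      rcases Finset.mem_insert.1 hj with rfl | hj
      exacts [h' x hx, h x (hV'V hx) j hj]
  obtain ⟨V, hVU, hV, hVne, h⟩ := key Finset.univ
  exact ⟨V, hVU, hV, hVne, fun x hx => continuousAt_pi.2 fun i => h x hx i (Finset.mem_univ i)⟩

/-- The general form, with an arbitrary map `G` having a coordinate left inverse, is what lets the
induction on `d` close: a lower-dimensional part of `D` is reparametrized by fewer of its own
coordinates, and the composite with `G` again has such a left inverse. -/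
theorem decomposable_image (d : ℕ) : ∀ {m : ℕ} (ι : Fin d ↪ Fin m) {D : Set (Fin d → M)}
    {G : (Fin d → M) → Fin m → M}, Dfn M (fun y => y ∈ D) → Dfn M G →
    (∀ y ∈ D, ∀ i, G y (ι i) = y i) → Decomposable (range ι) (G '' D) := by
  induction d using Nat.strong_induction_on with
  | _ d ih =>
  intro m ι D G hD hG hι
  let W : Set (Fin d → M) := {y | ∀ᶠ z in 𝓝 y, z ∈ D ∧ ContinuousAt G z}
  have hWo : IsOpen W := isOpen_setOfPred_eventually_nhds
  have hWd : Dfn M (fun y => y ∈ W) :=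
    Dfn.eventually_nhds (R := fun (_ : Fin d → M) z => z ∈ D ∧ ContinuousAt G z)
      (Dfn.and (by fun_prop) (Dfn.continuousAt (f := fun _ => G) (by fun_prop) (by fun_prop)))
      (by fun_prop)
  have hWD : W ⊆ D := fun y hy => hy.self_of_nhds.1
  have hW : Decomposable (range ι) (G '' W) := IsGraphPiece.decomposable
    ⟨d, ι, W, G, Subset.rfl, hWo, hWd, hG, fun y hy => hy.self_of_nhds.2.continuousWithinAt,
      fun y hy => hι y (hWD hy), rfl⟩
  have hZd : Dfn M (fun y => y ∈ D ∧ ¬ y ∈ W) := by fun_prop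
  -- Generic continuity: an open subset of `D` meets `W`.
  have hZ : ∀ U : Set (Fin d → M), IsOpen U → U.Nonempty → ¬ ∀ y ∈ U, y ∈ D ∧ ¬ y ∈ W := by
    intro U hU hne hUZ
    obtain ⟨V, hVU, hV, ⟨y, hy⟩, h⟩ := (tame_pow d).exists_continuousAt_pi hG hU hne
    exact (hUZ y (hVU hy)).2 (mem_of_superset (hV.mem_nhds hy)
      fun z hz => ⟨(hUZ z (hVU hz)).1, h z hz⟩)
  have hsplit : G '' D = G '' W ∪ G '' {y | y ∈ D ∧ ¬ y ∈ W} := by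
    rw [← image_union]
    congr 1
    ext y
    constructor
    · exact fun hy => (em (y ∈ W)).imp id fun h => ⟨hy, h⟩
    · exact fun hy => hy.elim (fun h => hWD h) fun h => h.1
  rw [hsplit]
  refine hW.union ?_
  rcases d with _ | e
  · have : {y | y ∈ D ∧ ¬ y ∈ W} = ∅ := by
      by_contra hne
      obtain ⟨y, hy⟩ := nonempty_iff_ne_empty.2 hne
      exact hZ univ isOpen_univ ⟨y, mem_univ y⟩ fun z _ => Subsingleton.elim y z ▸ hy
    rw [this, image_empty]
    exact Decomposable.empty
  generalize hZdef : {y | y ∈ D ∧ ¬ y ∈ W} = Z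
  have hZd : Dfn M (fun y => y ∈ Z) := by rw [← hZdef]; exact hZd
  have hZ : ∀ U : Set (Fin (e + 1) → M), IsOpen U → U.Nonempty → ¬ U ⊆ Z := by
    rw [← hZdef]; exact hZ
  have hιZ : ∀ y ∈ Z, ∀ i, G y (ι i) = y i := by
    rw [← hZdef]; exact fun y hy => hι y hy.1
  clear hsplit hW hWD hWd hWo hZdef
  let E : Set (Fin e → M) := {x | ∃ a b, a < b ∧ ∀ t, a < t → t < b → snocHomeo M e (x, t) ∈ Z}
  have hEd : Dfn M (fun x => x ∈ E) := Dfn.exists (Dfn.exists (Dfn.and (by fun_prop) (Dfn.forall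
    (Dfn.imp (by fun_prop) (Dfn.imp (by fun_prop) (by fun_prop))))))
  have hE : ∀ U : Set (Fin e → M), IsOpen U → U.Nonempty → ¬ U ⊆ E := by
    intro U hU hne hUE
    obtain ⟨V, hVU, hV, ⟨x, hx⟩, c, d, hcd, h⟩ := (tame_pow (M := M) e).exists_uniform_interval
      (R := fun x a b => ∀ t, a < t → t < b → snocHomeo M e (x, t) ∈ Z)
      (Dfn.forall (Dfn.imp (by fun_prop) (Dfn.imp (by fun_prop) (by fun_prop))))
      (fun x a b a' b' h ha _ hb t h1 h2 => h t (ha.trans_lt h1) (h2.trans_le hb)) hU hne hUE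
    obtain ⟨t, ht⟩ := exists_between hcd
    refine hZ (snocHomeo M e '' (V ×ˢ Ioo c d)) ((snocHomeo M e).isOpenMap _ (hV.prod isOpen_Ioo))
      ⟨_, (x, t), ⟨hx, ht⟩, rfl⟩ ?_
    rintro _ ⟨p, hp, rfl⟩
    exact h p.1 hp.1 p.2 hp.2.1 hp.2.2
  have hfin : ∀ x, {t | ¬ x ∈ E ∧ snocHomeo M e (x, t) ∈ Z}.Finite := by
    intro x
    by_contra hinf
    obtain ⟨a, b, hab, h⟩ := exists_Icc_of_infinite (M := M) (by fun_prop) hinf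
    exact (h a le_rfl hab.le).1 ⟨a, b, hab, fun t h1 h2 => (h t h1.le h2.le).2⟩
  have hRd : Dfn M (fun p : (Fin e → M) × M => ¬ p.1 ∈ E ∧ snocHomeo M e (p.1, p.2) ∈ Z) := by
    fun_prop
  obtain ⟨N, hN⟩ := unifFinite_pow e _ hRd hfin
  obtain ⟨f, hf, hfR⟩ := exists_enumeration N hRd hfin hN
  -- `E` is the image of itself under the identity, so the induction hypothesis decomposes it.
  obtain ⟨F, hF, hFp, hEF⟩ := ih e (Nat.lt_succ_self e) (Function.Embedding.refl _) hEd
    (Dfn.id : Dfn M (fun x : Fin e → M => x)) (fun y _ i => rfl)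
  rw [image_id'] at hEF
  have hsplit : G '' Z = (⋃ i, (fun x => G (snocHomeo M e (x, f i x))) ''
      {x | ¬ x ∈ E ∧ snocHomeo M e (x, f i x) ∈ Z}) ∪ ⋃ T ∈ F, G '' {z | z ∈ Z ∧ proj z ∈ T} := by
    ext y
    simp only [mem_union, mem_iUnion]
    constructor
    · rintro ⟨z, hz, rfl⟩
      by_cases hzE : proj z ∈ E
      · right
        rw [hEF] at hzE
        obtain ⟨T, hT, hzT⟩ := hzE
        exact ⟨T, hT, z, ⟨hz, hzT⟩, rfl⟩
      · left
        have hz' : snocHomeo M e (proj z, z (Fin.last e)) = z := (snocHomeo M e).right_inv z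
        obtain ⟨i, hi⟩ := hfR (proj z) (z (Fin.last e)) ⟨hzE, hz'.symm ▸ hz⟩
        refine ⟨i, proj z, ?_, ?_⟩
        · exact ⟨hzE, by rw [← hi, hz']; exact hz⟩
        · show G (snocHomeo M e (proj z, f i (proj z))) = G z
          rw [← hi, hz']
    · rintro (⟨i, x, hx, rfl⟩ | ⟨T, hT, z, hz, rfl⟩)
      · exact ⟨_, hx.2, rfl⟩
      · exact ⟨z, hz.1, rfl⟩
  rw [hsplit]
  refine Decomposable.union (Decomposable.iUnion fun i => ?_) (Decomposable.biUnion hF fun T hT => ?_)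
  · have hfi := hf i
    refine (ih e (Nat.lt_succ_self e) (Fin.castSuccEmb.trans ι)
      (D := {x | ¬ x ∈ E ∧ snocHomeo M e (x, f i x) ∈ Z}) ?_ ?_ ?_).mono ?_
    · show Dfn M (fun x => ¬ x ∈ E ∧ snocHomeo M e (x, f i x) ∈ Z)
      fun_prop
    · fun_prop
    · intro x hx j
      show G (snocHomeo M e (x, f i x)) (ι j.castSucc) = x j
      rw [hιZ _ hx.2, snocHomeo_castSucc]
    · rintro _ ⟨j, rfl⟩
      exact ⟨j.castSucc, rfl⟩
  · obtain ⟨d, κ, D', g, -, hD'o, hD'd, hg, hgc, hκ, rfl⟩ := hFp T hT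
    rcases D'.eq_empty_or_nonempty with rfl | ⟨y0, hy0⟩
    · convert Decomposable.empty using 1
      simp
    have hde : d ≤ e := by simpa using Fintype.card_le_of_embedding κ
    -- With `d = e` the coordinates `κ` would be a permutation and the piece would be a nonempty
    -- open subset of `E`.
    have hlt : d < e := by
      refine lt_of_le_of_ne hde ?_
      rintro rfl
      have hsurj : Function.Surjective κ := Finite.surjective_of_injective κ.injective
      refine hE {x | (fun i => x (κ i)) ∈ D'} (hD'o.preimage (f := fun (x : Fin d → M) i => x (κ i))
        (by fun_prop)) ⟨g y0, ?_⟩ ?_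
      · show (fun i => g y0 (κ i)) ∈ D'
        rwa [show (fun i => g y0 (κ i)) = y0 from funext (hκ y0 hy0)]
      · intro x hx
        rw [hEF]
        refine ⟨_, hT, _, hx, funext fun j => ?_⟩
        obtain ⟨i, rfl⟩ := hsurj j
        exact hκ _ hx i
    -- The part of `Z` above a piece is parametrized by the `d` coordinates of the piece together
    -- with the last one; `d + 1 ≤ e` allows the induction hypothesis.
    let κ' : Fin (d + 1) ↪ Fin (e + 1) :=
      ⟨Fin.snoc (α := fun _ => Fin (e + 1)) (fun i => (κ i).castSucc) (Fin.last e),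
        Fin.snoc_injective_of_injective ((Fin.castSucc_injective e).comp κ.injective) (by
          rintro ⟨i, hi⟩
          exact (Fin.castSucc_lt_last _).ne hi)⟩
    have hκl : κ' (Fin.last d) = Fin.last e :=
      Fin.snoc_last (α := fun _ => Fin (e + 1)) (Fin.last e) (fun i => (κ i).castSucc)
    have hκs : ∀ i, κ' i.castSucc = (κ i).castSucc :=
      fun i => Fin.snoc_castSucc (α := fun _ => Fin (e + 1)) (Fin.last e) (fun i => (κ i).castSucc) i
    have h := ih (d + 1) (by omega) (κ'.trans ι)
      (D := {w | proj w ∈ D' ∧ snocHomeo M e (g (proj w), w (Fin.last d)) ∈ Z})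
      (G := fun w => G (snocHomeo M e (g (proj w), w (Fin.last d))))
      (by
        show Dfn M (fun w => proj w ∈ D' ∧ snocHomeo M e (g (proj w), w (Fin.last d)) ∈ Z)
        fun_prop) (by fun_prop) (by
        intro w hw j
        show G _ (ι (κ' j)) = w j
        rw [hιZ _ hw.2]
        refine Fin.lastCases ?_ (fun j => ?_) j
        · rw [hκl, snocHomeo_last]
        · rw [hκs, snocHomeo_castSucc]
          exact hκ _ hw.1 j)
    convert h.mono (show range (κ'.trans ι) ⊆ range ι from range_comp_subset_range κ' ι) using 1
    ext y
    constructor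
    · rintro ⟨z, ⟨hz, y', hy', hyz⟩, rfl⟩
      have hz' : snocHomeo M e (proj z, z (Fin.last e)) = z := (snocHomeo M e).right_inv z
      have hw : snocHomeo M e (g (proj (snocHomeo M d (y', z (Fin.last e)))),
          snocHomeo M d (y', z (Fin.last e)) (Fin.last d)) = z := by
        rw [proj_snocHomeo, snocHomeo_last, hyz, hz']
      refine ⟨snocHomeo M d (y', z (Fin.last e)), ⟨?_, ?_⟩, ?_⟩
      · rwa [proj_snocHomeo]
      · rwa [hw]
      · exact congrArg G hw
    · rintro ⟨w, hw, rfl⟩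
      exact ⟨_, ⟨hw.2, by rw [proj_snocHomeo]; exact ⟨_, hw.1, rfl⟩⟩, rfl⟩

/-- The image of an open definable set under the projection is covered by finitely many open
definable sets with continuous definable sections. -/
theorem exists_sections {n : ℕ} {O : Set (Fin (n + 1) → M)} (hO : IsOpen O)
    (hOd : Dfn M (fun x => x ∈ O)) :
    ∃ (m : ℕ) (U : Fin m → Set (Fin n → M)),
      (∀ i, IsOpen (U i) ∧ Dfn M (fun x => x ∈ U i)) ∧ (⋃ i, U i) = proj '' O ∧
      ∀ i, ∃ s : (Fin n → M) → (Fin (n + 1) → M), MapsTo s (U i) O ∧ ContinuousOn s (U i) ∧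
        Dfn M s ∧ ∀ x ∈ U i, proj (s x) = x := by
  obtain ⟨h, hh, hhO⟩ := skolem (M := M) (X := Fin n → M) (Y := M)
    (R := fun x t => snocHomeo M n (x, t) ∈ O) (by fun_prop)
  have hOx : ∀ x ∈ O, snocHomeo M n (proj x, h (proj x)) ∈ O := fun x hx => hhO (proj x)
    ⟨x (Fin.last n), by rwa [show snocHomeo M n (proj x, x (Fin.last n)) = x from
      (snocHomeo M n).right_inv x]⟩
  have hDd : Dfn M (fun x => x ∈ {x : Fin n → M | snocHomeo M n (x, h x) ∈ O}) := by
    show Dfn M (fun x : Fin n → M => snocHomeo M n (x, h x) ∈ O)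
    fun_prop
  obtain ⟨F, hF, hFp, hcov⟩ := decomposable_image n Fin.castSuccEmb hDd
    (G := fun x => snocHomeo M n (x, h x)) (by fun_prop) (fun y _ i => snocHomeo_castSucc _ i)
  have hpiece : ∀ T ∈ F, ∃ U : Set (Fin n → M), (IsOpen U ∧ Dfn M (fun x => x ∈ U)) ∧
      U ⊆ proj '' O ∧ (∀ x, snocHomeo M n (x, h x) ∈ O → snocHomeo M n (x, h x) ∈ T → x ∈ U) ∧
      ∃ s : (Fin n → M) → (Fin (n + 1) → M), MapsTo s U O ∧ ContinuousOn s U ∧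
        Dfn M s ∧ ∀ x ∈ U, proj (s x) = x := by
    intro T hT
    obtain ⟨d, ι, D, g, hι, hDo, hDd, hg, hgc, hgι, rfl⟩ := hFp T hT
    -- The coordinates that parametrize a piece avoid the last one, so they can be read off from the
    -- base point.
    have : ∀ i, ∃ j : Fin n, j.castSucc = ι i := fun i => hι ⟨i, rfl⟩
    choose κ hκ using this
    let p : (Fin n → M) → (Fin d → M) := fun x i => x (κ i)
    have hp : Continuous p := by fun_prop
    have hpd : Dfn M p := by
      show Dfn M (fun (x : Fin n → M) i => x (κ i))
      fun_prop
    let s : (Fin n → M) → (Fin (n + 1) → M) := fun x => snocHomeo M n (x, g (p x) (Fin.last n))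
    have hsd : Dfn M s := by
      show Dfn M (fun x => snocHomeo M n (x, g (p x) (Fin.last n)))
      fun_prop
    have hsc : ContinuousOn s (p ⁻¹' D) := by
      refine (snocHomeo M n).continuous.comp_continuousOn (continuousOn_id.prodMk ?_)
      exact (continuous_apply _).comp_continuousOn (hgc.comp hp.continuousOn fun x hx => hx)
    refine ⟨p ⁻¹' D ∩ s ⁻¹' O, ⟨hsc.isOpen_inter_preimage (hDo.preimage hp) hO, ?_⟩, ?_, ?_,
      s, fun x hx => hx.2, hsc.mono inter_subset_left, hsd, fun x _ => proj_snocHomeo _⟩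
    · show Dfn M (fun x => p x ∈ D ∧ s x ∈ O)
      fun_prop
    · exact fun x hx => ⟨s x, hx.2, proj_snocHomeo _⟩
    -- At a base point of the piece `p x` is the original parameter, so `s x = (x, h x)`.
    · rintro x hx ⟨y, hy, hyx⟩
      have hpx : p x = y := by
        funext i
        rw [← hgι y hy i, hyx, ← hκ i, snocHomeo_castSucc]
      refine ⟨show p x ∈ D by rwa [hpx], ?_⟩
      show snocHomeo M n (x, g (p x) (Fin.last n)) ∈ O
      rwa [hpx, hyx, snocHomeo_last]
  choose! U hU hUO hcovU hs using hpiece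
  obtain ⟨m, e, -, he⟩ := hF.fin_param
  refine ⟨m, fun i => U (e i), fun i => hU _ (he ▸ mem_range_self i), ?_,
    fun i => hs _ (he ▸ mem_range_self i)⟩
  refine Subset.antisymm (iUnion_subset fun i => hUO _ (he ▸ mem_range_self i)) ?_
  rintro _ ⟨x, hx, rfl⟩
  have hmem : snocHomeo M n (proj x, h (proj x)) ∈ ⋃₀ F := by
    rw [← hcov]
    exact ⟨_, hOx x hx, rfl⟩
  obtain ⟨T, hT, hxT⟩ := hmem
  obtain ⟨i, rfl⟩ : T ∈ range e := he ▸ hT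
  exact mem_iUnion.2 ⟨i, hcovU _ hT _ (hOx x hx) hxT⟩

end Main

end OMin

theorem theorem3p2 (L : FirstOrder.Language.{u, v}) [L.IsOrdered] (M : Type w) [L.Structure M]
    [LinearOrder M] [L.OrderedStructure M] [Nonempty M] [DenselyOrdered M] [NoMinOrder M]
    [NoMaxOrder M] [TopologicalSpace M] [OrderTopology M]
    (homin : OMin.IsOMinimal L M) (hskolem : OMin.HasDefSkolem L M)
    (n : ℕ) (O : Set (Fin (n + 1) → M)) (hOopen : IsOpen O) (hOdef : OMin.IsDef L O) :
    ∃ (m : ℕ) (U : Fin m → Set (Fin n → M)),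
      (∀ i, IsOpen (U i) ∧ OMin.IsDef L (U i)) ∧
      (⋃ i, U i) = OMin.proj '' O ∧
      ∀ i, ∃ s : (Fin n → M) → (Fin (n + 1) → M),
        MapsTo s (U i) O ∧ ContinuousOn s (U i) ∧ OMin.IsDefMapOn L (U i) s ∧
          ∀ x ∈ U i, OMin.proj (s x) = x := by
  let _ := OMin.defStr L (M := M)
  have := OMin.ominSk L homin hskolem
  obtain ⟨m, U, hU, hcov, hs⟩ := OMin.exists_sections hOopen (OMin.dfn_iff_def.2 hOdef)
  refine ⟨m, U, fun i => ⟨(hU i).1, OMin.dfn_iff_def.1 (hU i).2⟩, hcov, fun i => ?_⟩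
  obtain ⟨s, h1, h2, h3, h4⟩ := hs i
  have hUd := (hU i).2
  have hp : OMin.Dfn M (fun p : Fin n ⊕ Fin (n + 1) → M => fun i => p (Sum.inl i)) := by fun_prop
  have key : OMin.Dfn M (fun p : Fin n ⊕ Fin (n + 1) → M =>
      p ∘ Sum.inl ∈ U i ∧ p ∘ Sum.inr = s (p ∘ Sum.inl)) :=
    OMin.Dfn.and (OMin.Dfn.comp hUd hp)
      (OMin.Dfn.eq (f := fun p i => p (Sum.inr i)) (by fun_prop) (OMin.Dfn.comp h3 hp))
  exact ⟨s, h1, h2, OMin.dfn_iff_def.1 key, h4⟩
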